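/- Let $G$ be a finite connected chordal graph that is not complete. The *weighted clique graph* $C(G)$ has the maximal cliques of $G$ as vertices; two distinct maximal cliques $K, K'$ are adjacent iff $K\cap K'$ is a minimal $x$-$y$ separator of $G$ for all $x\in K\setminus K'$ and $y\in K'\setminus K$. The edge $KK'$ has label $K\cap K'$ and weight $|K\cap K'|$. For a set $S$ of vertices of $G$, let $C(G)-S$ be the graph obtained from $C(G)$ by deleting all edges whose labels are subsets of $S$. A vertex $z$ is *simplicial* if its closed neighborhood $N[z]$ is a clique (then $N[z]$ is a maximal clique), and for such $z$ the *$z$-component* of $C(G)-S$ is its connected component containing $N[z]$. If $H$ is $C(G)$ or the $z$-component of some $C(G)-S$, an edge of $H$ is *critical* for $N[z]$ in $H$ if it has minimum weight among the edges of $H$ and one of its ends is connected to $N[z]$ after all minimum-weight edges of $H$ are removed. A *Prim ordering* of $C(G)$ is an ordering of all maximal cliques in which every clique but the first is included through an edge of maximum weight among all edges of $C(G)$ between cliques already visited and cliques not yet visited. Let $z$ be a simplicial vertex of $G$. Then $N[z]$ is the last clique of some Prim ordering of $C(G)$ if and only if there are $k\ge 1$ and a sequence of edges $e_1,\dots,e_k$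 of $C(G)$, with labels $S_1,\dots,S_k$ respectively, that occur in this order on a path of $C(G)$ ending at $N[z]$, such that 1. the critical edges for $N[z]$ in $C(G)$ all have label $S_1$, and $S_k$ is the set of non-simplicial vertices of $G$ in $N[z]$; and 2. for $1\le i<k$, the $z$-component of $C(G)-S_i$ has at least one critical edge for $N[z]$, and all its critical edges for $N[z]$ have the same label, which is $S_{i+1}$. Moreover, for any such sequence, every maximal clique of $G$ that is not in the $z$-component of $C(G)-S_1$ is the first clique of some Prim ordering of $C(G)$ that ends with $N[z]$. -/

import Mathlib

namespace PrimEnd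

variable {V : Type*}

/-- The closed neighborhood `N[v]`. -/
def closedNbhd (G : SimpleGraph V) (v : V) : Set V := insert v (G.neighborSet v)

/-- A vertex is simplicial if its closed neighborhood induces a complete graph. -/
def IsSimplicial (G : SimpleGraph V) (v : V) : Prop := G.IsClique (closedNbhd G v)

/-- Chordal: no induced cycle on four or more vertices
(an embedding `↪g` of graphs has an induced subgraph as its image). -/
def IsChordal (G : SimpleGraph V) : Prop :=
  ∀ n : ℕ, 4 ≤ n → IsEmpty (SimpleGraph.cycleGraph n ↪g G)

/-- `S` is a `u`-`v` separator: `u, v ∉ S`, and `u` and `v` are not connected in `G - S`. -/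
def IsSeparator (G : SimpleGraph V) (u v : V) (S : Set V) : Prop :=
  ∃ (hu : u ∈ Sᶜ) (hv : v ∈ Sᶜ), ¬ (G.induce Sᶜ).Reachable ⟨u, hu⟩ ⟨v, hv⟩

/-- A `u`-`v` separator no proper subset of which is a `u`-`v` separator. -/
def IsMinimalSeparator (G : SimpleGraph V) (u v : V) (S : Set V) : Prop :=
  IsSeparator G u v S ∧ ∀ T : Set V, T ⊂ S → ¬ IsSeparator G u v T

/-- The maximal cliques of `G` (the vertices of the weighted clique graph). -/
def MaxClique (G : SimpleGraph V) : Type _ :=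
  {K : Set V // Maximal (fun s : Set V => G.IsClique s) K}

instance (G : SimpleGraph V) [Finite V] : Finite (MaxClique G) :=
  inferInstanceAs (Finite {K : Set V // Maximal (fun s : Set V => G.IsClique s) K})

/-- The weighted clique graph `C(G)`: distinct maximal cliques `A`, `B` are adjacent iff `A ∩ B` is
a minimal `x`-`y` separator for all `x ∈ A \ B` and `y ∈ B \ A`. -/
def cliqueGraph (G : SimpleGraph V) : SimpleGraph (MaxClique G) where
  Adj A B := A ≠ B ∧
    ∀ x ∈ A.1 \ B.1, ∀ y ∈ B.1 \ A.1, IsMinimalSeparator G x y (A.1 ∩ B.1)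
  symm := ⟨by
    rintro A B ⟨hne, h⟩
    refine ⟨hne.symm, fun x hx y hy => ?_⟩
    have hsep : ∀ (u v : V) (S : Set V), IsSeparator G u v S → IsSeparator G v u S :=
      fun u v S ⟨hu, hv, hr⟩ => ⟨hv, hu, fun hr' => hr hr'.symm⟩
    have hyx := h y hy x hx
    rw [Set.inter_comm]
    exact ⟨hsep _ _ _ hyx.1, fun T hT hT' => hyx.2 T hT (hsep _ _ _ hT')⟩⟩
  loopless := ⟨fun _ h => h.1 rfl⟩

/-- The label of an edge `AB` of the clique graph is `A ∩ B`. -/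
def label {G : SimpleGraph V} : Sym2 (MaxClique G) → Set V :=
  Sym2.lift ⟨fun A B => A.1 ∩ B.1, fun A B => Set.inter_comm A.1 B.1⟩

/-- The weight of an edge is the cardinality of its label. -/
noncomputable def weight {G : SimpleGraph V} (e : Sym2 (MaxClique G)) : ℕ := (label e).ncard

/-- `C(G) - S`: delete from `C(G)` all edges whose labels are subsets of `S`. -/
def cliqueGraphMinus (G : SimpleGraph V) (S : Set V) : SimpleGraph (MaxClique G) :=
  (cliqueGraph G).deleteEdges {e | label e ⊆ S}

/-- The edges of `H` that lie in the connected component of `H` containing `K`; the vertices outside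
this component are kept as isolated vertices. -/
def componentOf {α : Type*} (H : SimpleGraph α) (K : α) : SimpleGraph α where
  Adj A B := H.Adj A B ∧ H.Reachable K A
  symm := ⟨fun _ _ h => ⟨h.1.symm, h.2.trans h.1.reachable⟩⟩
  loopless := ⟨fun _ h => h.1.ne rfl⟩

/-- `e` is an edge of `H` that has minimum weight among the edges of `H`. -/
def IsMinWeightEdge {G : SimpleGraph V} (H : SimpleGraph (MaxClique G))
    (e : Sym2 (MaxClique G)) : Prop :=
  e ∈ H.edgeSet ∧ ∀ f ∈ H.edgeSet, weight e ≤ weight f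

/-- `e` is a critical edge of `H` for `K`: a minimum-weight edge of `H`, one end of which is in the
same component as `K` after all minimum-weight edges of `H` are removed. -/
def IsCriticalEdge {G : SimpleGraph V} (H : SimpleGraph (MaxClique G)) (K : MaxClique G)
    (e : Sym2 (MaxClique G)) : Prop :=
  IsMinWeightEdge H e ∧
    ∃ A ∈ e, (H.deleteEdges {f | IsMinWeightEdge H f}).Reachable K A

/-- `S` is the common label of the critical edges of `H` for `K` (and there is such an edge). -/
def IsCriticalLabel {G : SimpleGraph V} (H : SimpleGraph (MaxClique G)) (K : MaxClique G)
    (S : Set V) : Prop :=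
  (∃ e, IsCriticalEdge H K e) ∧ ∀ e, IsCriticalEdge H K e → label e = S

/-- Orderings of the maximal cliques of `G`; positions are counted from `0`. -/
abbrev CliqueOrdering (G : SimpleGraph V) : Type _ := MaxClique G ≃ Fin (Nat.card (MaxClique G))

/-- Prim orderings of `C(G)` (for maximum spanning trees): every clique `B` but the first one is
included through an edge `AB` from a visited clique `A`, of maximum weight among all edges `CD`
between a visited clique `C` and an unvisited clique `D`. -/
def IsPrimOrdering {G : SimpleGraph V} (π : CliqueOrdering G) : Prop :=
  ∀ B : MaxClique G, 0 < (π B).val →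
    ∃ A, π A < π B ∧ (cliqueGraph G).Adj A B ∧
      ∀ C D, π C < π B → π B ≤ π D → (cliqueGraph G).Adj C D → weight s(C, D) ≤ weight s(A, B)

/-- `K` is the first clique of the ordering. -/
def StartsWith {G : SimpleGraph V} (π : CliqueOrdering G) (K : MaxClique G) : Prop :=
  (π K).val = 0

/-- `K` is the last clique of the ordering. -/
def EndsWith {G : SimpleGraph V} (π : CliqueOrdering G) (K : MaxClique G) : Prop :=
  (π K).val + 1 = Nat.card (MaxClique G)

theorem isMaximalClique_closedNbhd {G : SimpleGraph V} {z : V} (hz : IsSimplicial G z) :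
    Maximal (fun s : Set V => G.IsClique s) (closedNbhd G z) := by
  refine ⟨hz, fun t ht hle x hx => ?_⟩
  by_cases hxz : x = z
  · exact Or.inl hxz
  · exact Or.inr (ht (hle (Or.inl rfl)) hx (Ne.symm hxz))

/-- For a simplicial vertex `z`, the maximal clique `N[z]`. -/
def nbhdClique {G : SimpleGraph V} {z : V} (hz : IsSimplicial G z) : MaxClique G :=
  ⟨closedNbhd G z, isMaximalClique_closedNbhd hz⟩

/-- The sequence of edges `e 0, …, e m` of `C(G)` (that is, `e_1, …, e_k` with `k = m + 1`) lies, in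
this order, on a path of `C(G)` ending at `N[z]`, and its labels `S_i = label (e (i - 1))` satisfy:
`S_1` is the label of the critical edges for `N[z]`; `S_k` is the set of non-simplicial vertices of
`N[z]`; `S_{i+1}` is the common label of all critical edges for `N[z]` in the `z`-component of
`C(G) - S_i`. -/
structure IsCriticalChain {G : SimpleGraph V} {z : V} (hz : IsSimplicial G z) {m : ℕ}
    (e : Fin (m + 1) → Sym2 (MaxClique G)) : Prop where
  on_path : ∃ (A : MaxClique G) (p : (cliqueGraph G).Walk A (nbhdClique hz)),
    p.IsPath ∧ (List.ofFn e).Sublist p.edges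
  first : IsCriticalLabel (cliqueGraph G) (nbhdClique hz) (label (e 0))
  last : label (e (Fin.last m)) = {v ∈ closedNbhd G z | ¬ IsSimplicial G v}
  step : ∀ i : Fin m,
    IsCriticalLabel (componentOf (cliqueGraphMinus G (label (e i.castSucc))) (nbhdClique hz))
      (nbhdClique hz) (label (e i.succ))

end PrimEnd

/-!
The proof reduces the graph `G` to three facts about its maximal cliques, and then argues about the
clique graph `C(G)` and its labels only.

* If `K` and `K'` are joined in `C(G) - S`, then they are joined there by edges whose labels contain
  `K ∩ K'` (`IsChordal.reachable_labelGraph_of_reachable`). Indeed, an induced path of `G - S`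
  between two common neighbours of a clique `T ⊆ S` is complete to `T` by chordality, so that
  the maximal cliques along the path share `T` and vertices outside `S`.
* The ends of an edge with label `S` are not joined in `C(G) - S` (`not_reachable_of_adj`).
* If `K` and `K'` are not joined in `C(G) - (K ∩ K')`, then they are adjacent
  (`IsChordal.adj_of_not_reachable`).

Call a connected set `D` of cliques containing `Z = N[z]` a *block* if the edges inside `D` are
heavier than those leaving it, and let its *core* be the component of `Z` after removal of the edges
of minimum weight inside `D`. The core is again a block, and the critical edges of `D` are exactly
the edges that leave the core inside `D`. The three facts imply that `D` minus its core is connected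
if and only if the critical edges have a common label, provided that `D ≠ {Z}`
(`IsBlock.reachable_diff_core`, `IsBlock.exists_isCriticalLabel`). If this common label is `S` and
`D` has been entered outside the core, through an edge with label `S₀` such that `D` is the
`Z`-component of `C(G) - S₀`, then the core is the `Z`-component of `C(G) - S`
(`IsBlock.sepComp_eq_core`).

A Prim ordering ending with `Z` visits each block of the sequence of iterated cores last: it visits
the block minus its core first, through edges inside this set, and then enters the core through a
critical edge. Hence the critical edges at each stage have a common label, and the edges through
which the cores are entered form the required sequence (`IsPrimOrdering.exists_list`).

Conversely, let `S 0, S 1, …` be the labels of a critical chain. If the `Z`-components of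
`C(G) - S i` are successive cores, then a Prim traversal that starts outside the first one can visit
everything outside one core before it enters the next one, and it ends with `Z`
(`isPrimVisited_compl_level`). What has to be excluded is that each clique through which some core
can be entered already lies in the next core. In that case the component of the next label contains
edges labelled by earlier labels, the lightest of which are critical again, so that the label after
the next one is some earlier `S j`. Since each label determines its successor, the sequence would be
periodic and could never isolate `Z` (`exists_entrance`).

Both directions stop at the core `{Z}`, since `C(G) - S` isolates `N[z]`, for the label `S` of an
edge at `N[z]`, if and only if `S` consists of the non-simplicial vertices of `N[z]`
(`sepComp_nonsimplicial`, `IsChordal.eq_nonsimplicial`).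
-/

namespace PrimEnd

/-! ### Induced paths in chordal graphs -/

section Chordal

variable {V : Type*} {G : SimpleGraph V}

lemma cycleGraph_adj_iff_of_lt {n : ℕ} (hn : 3 ≤ n) {i j : Fin n} (hij : i < j) :
    (SimpleGraph.cycleGraph n).Adj i j ↔ j.val = i.val + 1 ∨ (i.val = 0 ∧ j.val + 1 = n) := by
  have hi := i.isLt
  have hj := j.isLt
  have hlt : i.val < j.val := hij
  have h1 : (j - i).val = j.val - i.val := Fin.sub_val_of_le hij.le
  have h2 : (i - j).val = n - j.val + i.val := by
    rw [Fin.val_sub]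
    exact Nat.mod_eq_of_lt (by omega)
  rw [SimpleGraph.cycleGraph_adj', h1, h2]
  omega

/-- A vertex `s` adjacent to both ends but to no inner vertex of an induced path with at least one
inner vertex would close that path to an induced cycle of length at least four. -/
lemma IsChordal.false_of_inducedPath (hG : IsChordal G) {x : ℕ → V} {s : V} {a b : ℕ}
    (hab : a + 2 ≤ b)
    (hne : ∀ i j, a ≤ i → i < j → j ≤ b → x i ≠ x j)
    (hadj : ∀ i j, a ≤ i → i < j → j ≤ b → (G.Adj (x i) (x j) ↔ j = i + 1))
    (hs : ∀ i, a ≤ i → i ≤ b → s ≠ x i)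
    (hsadj : ∀ i, a ≤ i → i ≤ b → (G.Adj s (x i) ↔ i = a ∨ i = b)) : False := by
  set n := b - a + 2 with hn
  let f : Fin n → V := fun i => if i.val = 0 then s else x (a + i.val - 1)
  have key : ∀ i j : Fin n, i < j →
      f i ≠ f j ∧ (G.Adj (f i) (f j) ↔ (SimpleGraph.cycleGraph n).Adj i j) := by
    intro i j hij
    have hi := i.isLt
    have hj := j.isLt
    have hlt : i.val < j.val := hij
    rw [cycleGraph_adj_iff_of_lt (by omega) hij]
    have hj0 : j.val ≠ 0 := by omega
    by_cases hi0 : i.val = 0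
    · simp only [f, hi0, if_true, hj0, if_false, true_and]
      refine ⟨hs _ (by omega) (by omega), ?_⟩
      rw [hsadj _ (by omega) (by omega)]
      omega
    · simp only [f, hi0, hj0, if_false, false_and, or_false]
      refine ⟨hne _ _ (by omega) (by omega) (by omega), ?_⟩
      rw [hadj _ _ (by omega) (by omega) (by omega)]
      omega
  have hinj : Function.Injective f := by
    intro i j h
    rcases lt_trichotomy i j with hij | hij | hij
    · exact ((key i j hij).1 h).elim
    · exact hij
    · exact ((key j i hij).1 h.symm).elim
  refine (hG n (by omega)).false ⟨⟨f, hinj⟩, ?_⟩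
  intro i j
  change G.Adj (f i) (f j) ↔ _
  rcases lt_trichotomy i j with hij | hij | hij
  · exact (key i j hij).2
  · subst hij; simp
  · rw [G.adj_comm, SimpleGraph.adj_comm (SimpleGraph.cycleGraph n)]
    exact (key j i hij).2

/-- In a chordal graph, a vertex adjacent to both ends of an induced path avoiding it is adjacent
to every vertex of the path. -/
lemma IsChordal.adj_of_inducedPath (hG : IsChordal G) {x : ℕ → V} {s : V} {r : ℕ}
    (hne : ∀ i j, i < j → j ≤ r → x i ≠ x j)
    (hadj : ∀ i j, i < j → j ≤ r → (G.Adj (x i) (x j) ↔ j = i + 1))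
    (hs : ∀ i, i ≤ r → s ≠ x i) (h0 : G.Adj s (x 0)) (hr : G.Adj s (x r)) :
    ∀ i, i ≤ r → G.Adj s (x i) := by
  classical
  intro c hc
  by_contra hcs
  -- the closest neighbours of `s` on the two sides of `x c`
  have hex : ∃ d, c + d ≤ r ∧ G.Adj s (x (c + d)) :=
    ⟨r - c, by omega, by rwa [show c + (r - c) = r by omega]⟩
  have hex' : ∃ d, d ≤ c ∧ G.Adj s (x (c - d)) := ⟨c, le_rfl, by simpa using h0⟩
  obtain ⟨h1, h2⟩ := Nat.find_spec hex
  obtain ⟨h3, h4⟩ := Nat.find_spec hex'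
  have hm := fun d => @Nat.find_min _ _ hex d
  have hm' := fun d => @Nat.find_min _ _ hex' d
  generalize Nat.find hex = d at h1 h2 hm
  generalize Nat.find hex' = d' at h3 h4 hm'
  have hd : d ≠ 0 := by rintro rfl; exact hcs h2
  have hd' : d' ≠ 0 := by rintro rfl; exact hcs h4
  refine hG.false_of_inducedPath (x := x) (s := s) (a := c - d') (b := c + d) (by omega)
    (fun i j _ h h' => hne i j h (by omega)) (fun i j _ h h' => hadj i j h (by omega))
    (fun i _ h => hs i (by omega)) ?_
  intro i hi hi'
  constructor
  · intro h
    by_contra hcon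
    rcases le_total c i with hci | hci
    · exact hm (i - c) (by omega) ⟨by omega, by rwa [show c + (i - c) = i by omega]⟩
    · exact hm' (c - i) (by omega) ⟨by omega, by rwa [show c - (c - i) = i by omega]⟩
  · rintro (rfl | rfl)
    · exact h4
    · exact h2

lemma dist_getVert_of_length_eq_dist {W : Type*} {H : SimpleGraph W} {u v : W}
    (p : H.Walk u v) (hp : p.length = H.dist u v) {i : ℕ} (hi : i ≤ p.length) :
    H.dist u (p.getVert i) = i := by
  have h1 : H.dist u (p.getVert i) ≤ i := by
    refine (SimpleGraph.dist_le (p.take i)).trans ?_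
    simp
  have h2 : H.dist (p.getVert i) v ≤ p.length - i := by
    refine (SimpleGraph.dist_le (p.drop i)).trans ?_
    simp
  have h3 := (p.take i).reachable.dist_triangle_left v
  omega

/-- Two vertices of `G - S` that lie in one component of `G - S` and are complete to `T ⊆ S` are
joined, in a chordal graph, by a walk of `G - S` all of whose vertices are complete to `T`. -/
lemma IsChordal.exists_walk_complete (hG : IsChordal G) {S T : Set V} (hTS : T ⊆ S)
    {u v : (Sᶜ : Set V)} (huv : (G.induce Sᶜ).Reachable u v)
    (hu : ∀ t ∈ T, G.Adj t u) (hv : ∀ t ∈ T, G.Adj t v) :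
    ∃ p : (G.induce Sᶜ).Walk u v, ∀ w ∈ p.support, ∀ t ∈ T, G.Adj t w := by
  obtain ⟨p, hp⟩ := huv.exists_walk_length_eq_dist
  have hd : ∀ i, i ≤ p.length → (G.induce Sᶜ).dist u (p.getVert i) = i :=
    fun i hi => dist_getVert_of_length_eq_dist p hp hi
  refine ⟨p, ?_⟩
  intro w hw t ht
  obtain ⟨i, rfl, hi⟩ := SimpleGraph.Walk.mem_support_iff_exists_getVert.mp hw
  refine hG.adj_of_inducedPath (x := fun i => (p.getVert i : V)) (r := p.length) ?_ ?_ ?_ ?_ ?_ i hi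
  · intro i j hij hj h
    have h1 := hd i (by omega)
    have h2 := hd j hj
    rw [Subtype.ext h] at h1
    omega
  · intro i j hij hj
    constructor
    · intro h
      have h' : (G.induce Sᶜ).Adj (p.getVert i) (p.getVert j) := h
      have h1 := hd i (by omega)
      have h2 := hd j hj
      have h3 := (p.take i).reachable.dist_triangle_left (p.getVert j)
      have h4 := SimpleGraph.dist_eq_one_iff_adj.mpr h'
      omega
    · rintro rfl
      exact p.adj_getVert_succ (by omega)
  · intro i _ h
    exact (p.getVert i).2 (h ▸ hTS ht)
  · simpa using hu t ht
  · simpa using hv t ht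

end Chordal

/-! ### Reachability in the weighted clique graph -/

section Cliques

variable {V : Type*} {G : SimpleGraph V}

lemma MaxClique.adj (K : MaxClique G) {x y : V} (hx : x ∈ K.1) (hy : y ∈ K.1) (h : x ≠ y) :
    G.Adj x y := K.2.1 hx hy h

lemma MaxClique.eq_of_subset {K K' : MaxClique G} (h : K.1 ⊆ K'.1) : K = K' :=
  Subtype.ext (K.2.eq_of_subset K'.2.1 h)

lemma exists_maxClique_superset [Finite V] {s : Set V} (hs : G.IsClique s) :
    ∃ K : MaxClique G, s ⊆ K.1 := by
  obtain ⟨K, h, hK⟩ := (Set.toFinite {s : Set V | G.IsClique s}).exists_le_maximal hs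
  exact ⟨⟨K, hK⟩, h⟩

/-- The spanning subgraph of the clique graph formed by the edges whose labels satisfy `p`. -/
def labelGraph (G : SimpleGraph V) (p : Set V → Prop) : SimpleGraph (MaxClique G) where
  Adj A B := (cliqueGraph G).Adj A B ∧ p (A.1 ∩ B.1)
  symm := ⟨fun A B h => ⟨h.1.symm, by rw [Set.inter_comm]; exact h.2⟩⟩
  loopless := ⟨fun _ h => h.1.ne rfl⟩

lemma cliqueGraphMinus_adj {S : Set V} {A B : MaxClique G} :
    (cliqueGraphMinus G S).Adj A B ↔ (cliqueGraph G).Adj A B ∧ ¬ A.1 ∩ B.1 ⊆ S := by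
  simp [cliqueGraphMinus, SimpleGraph.deleteEdges_adj, label]

lemma labelGraph_mono {p q : Set V → Prop} (h : ∀ s, p s → q s) :
    labelGraph G p ≤ labelGraph G q :=
  fun _ _ hab => ⟨hab.1, h _ hab.2⟩

lemma reachable_of_reflTransGen {α : Type*} {H : SimpleGraph α} {r : α → α → Prop}
    (h : ∀ a b, r a b → H.Reachable a b) {a b : α} (hab : Relation.ReflTransGen r a b) :
    H.Reachable a b := by
  induction hab with
  | refl => rfl
  | tail _ hbc ih => exact ih.trans (h _ _ hbc)

/-- The cliques containing the successive edges of a walk of `G - S` that is complete to `T` form a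
chain of maximal cliques in which consecutive ones share `T` and a vertex outside `S`. -/
lemma reflTransGen_of_walk [Finite V] {S T : Set V} (hT : G.IsClique T)
    {u v : (Sᶜ : Set V)} (p : (G.induce Sᶜ).Walk u v)
    (hp : ∀ w ∈ p.support, ∀ t ∈ T, G.Adj t w) {K K' : MaxClique G}
    (hTK : T ⊆ K.1) (hTK' : T ⊆ K'.1) (huK : u.1 ∈ K.1) (hvK' : v.1 ∈ K'.1) :
    Relation.ReflTransGen (fun X Y : MaxClique G => ¬ X.1 ∩ Y.1 ⊆ S ∧ T ⊆ X.1 ∩ Y.1) K K' := by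
  induction p generalizing K with
  | @nil u =>
    refine Relation.ReflTransGen.single ⟨?_, Set.subset_inter hTK hTK'⟩
    exact fun h => u.2 (h ⟨huK, hvK'⟩)
  | @cons u w v huw q ih =>
    have hadj : G.Adj u.1 w.1 := huw
    have hcl : G.IsClique (insert u.1 (insert w.1 T)) := by
      rw [SimpleGraph.isClique_insert, SimpleGraph.isClique_insert]
      refine ⟨⟨hT, fun t ht _ => (hp w (by simp) t ht).symm⟩, ?_⟩
      rintro b (rfl | hb) _
      · exact hadj
      · exact (hp u (by simp) b hb).symm
    obtain ⟨M, hM⟩ := exists_maxClique_superset hcl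
    have hTM : T ⊆ M.1 := fun t ht => hM (by simp [ht])
    refine Relation.ReflTransGen.head (b := M) ⟨?_, Set.subset_inter hTK hTM⟩ ?_
    · exact fun h => u.2 (h ⟨huK, hM (by simp)⟩)
    · exact ih (fun x hx => hp x (by simp [hx])) hTM (hM (by simp)) hvK'

lemma IsChordal.reflTransGen_inter [Finite V] (hG : IsChordal G) {S : Set V} {K K' : MaxClique G}
    {u v : (Sᶜ : Set V)} (huK : u.1 ∈ K.1) (hvK' : v.1 ∈ K'.1)
    (huv : (G.induce Sᶜ).Reachable u v) :
    Relation.ReflTransGen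
      (fun X Y : MaxClique G => ¬ X.1 ∩ Y.1 ⊆ S ∧ K.1 ∩ K'.1 ⊆ X.1 ∩ Y.1) K K' := by
  by_cases hS : K.1 ∩ K'.1 ⊆ S
  · obtain ⟨p, hp⟩ := hG.exists_walk_complete hS huv
      (fun t ht => K.adj ht.1 huK fun h => u.2 (h ▸ hS ht))
      (fun t ht => K'.adj ht.2 hvK' fun h => v.2 (h ▸ hS ht))
    exact reflTransGen_of_walk (K.2.1.subset Set.inter_subset_left) p hp Set.inter_subset_left
      Set.inter_subset_right huK hvK'
  · exact Relation.ReflTransGen.single ⟨hS, subset_rfl⟩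

/-- Two distinct maximal cliques whose differences are not joined in `G` minus their intersection
are adjacent in the clique graph: minimality of the separator is automatic. -/
lemma cliqueGraph_adj_of_isSeparator {K K' : MaxClique G} (hne : K ≠ K')
    (h : ∀ x (hx : x ∈ (K.1 ∩ K'.1)ᶜ) y (hy : y ∈ (K.1 ∩ K'.1)ᶜ), x ∈ K.1 → y ∈ K'.1 →
      ¬ (G.induce (K.1 ∩ K'.1)ᶜ).Reachable ⟨x, hx⟩ ⟨y, hy⟩) :
    (cliqueGraph G).Adj K K' := by
  refine ⟨hne, fun x hx y hy => ⟨⟨fun h => hx.2 h.2, fun h => hy.2 h.1, ?_⟩, ?_⟩⟩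
  · exact h _ _ _ _ hx.1 hy.1
  · rintro T hT ⟨hxT, hyT, hr⟩
    obtain ⟨t, ht, htT⟩ := Set.exists_of_ssubset hT
    have h1 : (G.induce Tᶜ).Adj ⟨x, hxT⟩ ⟨t, htT⟩ :=
      K.adj hx.1 ht.1 (by rintro rfl; exact hx.2 ht.2)
    have h2 : (G.induce Tᶜ).Adj ⟨t, htT⟩ ⟨y, hyT⟩ :=
      K'.adj ht.2 hy.1 (by rintro rfl; exact hy.2 ht.1)
    exact hr (h1.reachable.trans h2.reachable)

/-- Any two maximal cliques `K`, `K'` of a chordal graph are joined in the clique graph by edges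
whose labels contain `K ∩ K'`. -/
lemma IsChordal.reachable_labelGraph_inter [Finite V] (hG : IsChordal G) (K K' : MaxClique G) :
    (labelGraph G fun L => K.1 ∩ K'.1 ⊆ L).Reachable K K' := by
  by_cases hne : K = K'
  · rw [hne]
  by_cases hadj : (cliqueGraph G).Adj K K'
  · exact SimpleGraph.Adj.reachable (G := labelGraph G _) ⟨hadj, subset_rfl⟩
  have hsep := mt (cliqueGraph_adj_of_isSeparator hne) hadj
  push Not at hsep
  obtain ⟨x, hx, y, hy, hxK, hyK', hr⟩ := hsep
  refine reachable_of_reflTransGen ?_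
    (hG.reflTransGen_inter (u := ⟨x, hx⟩) (v := ⟨y, hy⟩) hxK hyK' hr)
  rintro X Y ⟨h1, h2⟩
  exact (hG.reachable_labelGraph_inter X Y).mono (labelGraph_mono fun s hs => h2.trans hs)
termination_by Nat.card V - (K.1 ∩ K'.1).ncard
decreasing_by
  have h3 : (K.1 ∩ K'.1).ncard < (X.1 ∩ Y.1).ncard :=
    Set.ncard_lt_ncard ⟨h2, h1⟩ (Set.toFinite _)
  have h4 : (X.1 ∩ Y.1).ncard ≤ Nat.card V := Set.ncard_le_card _
  omega

/-- Cliques joined in `C(G) - S` have vertices outside `S` that are joined in `G - S`. -/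
lemma reachable_induce_of_reachable {S : Set V} {K K' : MaxClique G}
    (h : (cliqueGraphMinus G S).Reachable K K') {x y : V} (hx : x ∈ Sᶜ) (hy : y ∈ Sᶜ)
    (hxK : x ∈ K.1) (hyK' : y ∈ K'.1) : (G.induce Sᶜ).Reachable ⟨x, hx⟩ ⟨y, hy⟩ := by
  have hclique : ∀ (M : MaxClique G) (a b : V) (ha : a ∈ Sᶜ) (hb : b ∈ Sᶜ), a ∈ M.1 → b ∈ M.1 →
      (G.induce Sᶜ).Reachable ⟨a, ha⟩ ⟨b, hb⟩ := by
    intro M a b ha hb haM hbM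
    by_cases hab : a = b
    · subst hab; rfl
    · exact SimpleGraph.Adj.reachable (G := G.induce Sᶜ) (M.adj haM hbM hab)
  obtain ⟨p⟩ := h
  induction p generalizing x with
  | nil => exact hclique _ _ _ _ _ hxK hyK'
  | cons hadj p ih =>
    obtain ⟨-, hnot⟩ := cliqueGraphMinus_adj.mp hadj
    obtain ⟨t, ht, htS⟩ := Set.not_subset.mp hnot
    exact (hclique _ x t hx htS hxK ht.1).trans (ih htS ht.2 hyK')

/-- If `K`, `K'` are joined in `C(G) - S`, then they are joined there by edges whose labels contain
`K ∩ K'`. -/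
lemma IsChordal.reachable_labelGraph_of_reachable [Finite V] (hG : IsChordal G) {S : Set V}
    {K K' : MaxClique G} (h : (cliqueGraphMinus G S).Reachable K K') :
    (labelGraph G fun L => ¬ L ⊆ S ∧ K.1 ∩ K'.1 ⊆ L).Reachable K K' := by
  by_cases hne : K = K'
  · rw [hne]
  have hout : ∀ {A B : MaxClique G}, A ≠ B → (cliqueGraphMinus G S).Reachable A B →
      ∃ x ∈ A.1, x ∈ Sᶜ := by
    rintro A B hAB ⟨p⟩
    cases p with
    | nil => exact (hAB rfl).elim
    | cons hadj p =>
      obtain ⟨t, ht, htS⟩ := Set.not_subset.mp (cliqueGraphMinus_adj.mp hadj).2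
      exact ⟨t, ht.1, htS⟩
  obtain ⟨x, hxK, hx⟩ := hout hne h
  obtain ⟨y, hyK', hy⟩ := hout (Ne.symm hne) h.symm
  refine reachable_of_reflTransGen ?_ (hG.reflTransGen_inter (u := ⟨x, hx⟩) (v := ⟨y, hy⟩) hxK hyK'
    (reachable_induce_of_reachable h hx hy hxK hyK'))
  rintro X Y ⟨h1, h2⟩
  exact (hG.reachable_labelGraph_inter X Y).mono
    (labelGraph_mono fun s hs => ⟨fun h => h1 (hs.trans h), h2.trans hs⟩)

/-- The ends of an edge are in different components once the edges with labels inside its own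
label are deleted. -/
lemma not_reachable_of_adj {K K' : MaxClique G} (h : (cliqueGraph G).Adj K K') :
    ¬ (cliqueGraphMinus G (K.1 ∩ K'.1)).Reachable K K' := by
  intro hr
  obtain ⟨x, hx, hxK'⟩ := Set.not_subset.mp (mt MaxClique.eq_of_subset h.1)
  obtain ⟨y, hy, hyK⟩ := Set.not_subset.mp (mt MaxClique.eq_of_subset h.1.symm)
  obtain ⟨⟨h1, h2, h3⟩, -⟩ := h.2 x ⟨hx, hxK'⟩ y ⟨hy, hyK⟩
  exact h3 (reachable_induce_of_reachable hr h1 h2 hx hy)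

/-- The converse of `not_reachable_of_adj`. -/
lemma IsChordal.adj_of_not_reachable [Finite V] (hG : IsChordal G) {K K' : MaxClique G}
    (h : ¬ (cliqueGraphMinus G (K.1 ∩ K'.1)).Reachable K K') : (cliqueGraph G).Adj K K' := by
  refine cliqueGraph_adj_of_isSeparator (fun hne => h (by rw [hne])) ?_
  intro x hx y hy hxK hyK' hr
  refine h (reachable_of_reflTransGen ?_
    (hG.reflTransGen_inter (u := ⟨x, hx⟩) (v := ⟨y, hy⟩) hxK hyK' hr))
  rintro X Y ⟨h1, -⟩
  refine (hG.reachable_labelGraph_inter X Y).mono ?_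
  intro A B hAB
  exact cliqueGraphMinus_adj.mpr ⟨hAB.1, fun hle => h1 (hAB.2.trans hle)⟩

end Cliques

/-! ### Blocks of the clique graph and their cores -/

section Blocks

variable {V : Type*} {G : SimpleGraph V}

lemma reachable_induction {α : Type*} {H : SimpleGraph α} {P : α → Prop} {a b : α}
    (h : H.Reachable a b) (ha : P a) (step : ∀ u w, H.Adj u w → P u → P w) : P b := by
  obtain ⟨p⟩ := h
  induction p with
  | nil => exact ha
  | cons hadj _ ih => exact ih (step _ _ hadj ha)

/-- The edges of the clique graph with both ends in `D`; the cliques outside `D` are kept as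
isolated vertices. -/
def cliqueGraphOn (D : Set (MaxClique G)) : SimpleGraph (MaxClique G) where
  Adj A B := (cliqueGraph G).Adj A B ∧ A ∈ D ∧ B ∈ D
  symm := ⟨fun _ _ h => ⟨h.1.symm, h.2.2, h.2.1⟩⟩
  loopless := ⟨fun _ h => h.1.ne rfl⟩

/-- The vertex set of the connected component of `C(G) - S` that contains `Z`. -/
def sepComp (S : Set V) (Z : MaxClique G) : Set (MaxClique G) :=
  {K | (cliqueGraphMinus G S).Reachable Z K}

/-- The edges inside `D` that do not have minimum weight there. -/
def heavyGraph (D : Set (MaxClique G)) : SimpleGraph (MaxClique G) :=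
  (cliqueGraphOn D).deleteEdges {f | IsMinWeightEdge (cliqueGraphOn D) f}

/-- The cliques that stay connected to `Z` when the edges of minimum weight inside `D` are
removed. The critical edges are those leaving this set inside `D`. -/
def core (D : Set (MaxClique G)) (Z : MaxClique G) : Set (MaxClique G) :=
  {K | (heavyGraph D).Reachable Z K}

/-- A set of maximal cliques containing `Z` that is connected in the clique graph and has only
edges heavier than those leaving it. A Prim traversal that has entered such a set finishes it
before leaving it again. -/
structure IsBlock (D : Set (MaxClique G)) (Z : MaxClique G) : Prop where
  mem : Z ∈ D
  conn : ∀ K ∈ D, (cliqueGraphOn D).Reachable Z K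
  lt : ∀ P Q R U, (cliqueGraph G).Adj P Q → P ∈ D → Q ∈ D → (cliqueGraph G).Adj R U → R ∈ D →
    U ∉ D → weight s(R, U) < weight s(P, Q)

variable {D : Set (MaxClique G)} {Z : MaxClique G} {S : Set V}

lemma cliqueGraphOn_univ : cliqueGraphOn (Set.univ : Set (MaxClique G)) = cliqueGraph G := by
  ext A B
  simp [cliqueGraphOn]

lemma IsMinWeightEdge.le {A B P Q : MaxClique G}
    (h : IsMinWeightEdge (cliqueGraphOn D) s(A, B)) (hPQ : (cliqueGraph G).Adj P Q) (hP : P ∈ D)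
    (hQ : Q ∈ D) : weight s(A, B) ≤ weight s(P, Q) :=
  h.2 s(P, Q) ⟨hPQ, hP, hQ⟩

lemma heavyGraph_adj {A B : MaxClique G} :
    (heavyGraph D).Adj A B ↔ ((cliqueGraph G).Adj A B ∧ A ∈ D ∧ B ∈ D) ∧
      ¬ IsMinWeightEdge (cliqueGraphOn D) s(A, B) := by
  simp [heavyGraph, SimpleGraph.deleteEdges_adj, cliqueGraphOn]

lemma self_mem_core : Z ∈ core D Z := SimpleGraph.Reachable.refl _

lemma core_subset (hZ : Z ∈ D) : core D Z ⊆ D := fun _ hK =>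
  reachable_induction hK hZ fun _ _ h _ => (heavyGraph_adj.mp h).1.2.2

lemma heavyGraph_le [Finite V] {e : Sym2 (MaxClique G)}
    (he : IsMinWeightEdge (cliqueGraphOn D) e) :
    heavyGraph D ≤ cliqueGraphMinus G (label e) := by
  intro A B hAB
  obtain ⟨⟨h1, h2, h3⟩, h4⟩ := heavyGraph_adj.mp hAB
  refine cliqueGraphMinus_adj.mpr ⟨h1, fun hle => h4 ⟨⟨h1, h2, h3⟩, fun f hf => ?_⟩⟩
  exact (Set.ncard_le_ncard hle (Set.toFinite _)).trans (he.2 f hf)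

lemma core_subset_sepComp [Finite V] {e : Sym2 (MaxClique G)}
    (he : IsMinWeightEdge (cliqueGraphOn D) e) : core D Z ⊆ sepComp (label e) Z :=
  fun _ hK => hK.mono (heavyGraph_le he)

/-- No edge of minimum weight has both ends in the core: they would be joined by heavier edges. -/
lemma not_isMinWeightEdge_of_mem_core [Finite V] {A B : MaxClique G}
    (h : (cliqueGraph G).Adj A B) (hA : A ∈ core D Z) (hB : B ∈ core D Z) :
    ¬ IsMinWeightEdge (cliqueGraphOn D) s(A, B) := fun he =>
  not_reachable_of_adj h ((hA.symm.trans hB).mono (heavyGraph_le he))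

lemma isMinWeightEdge_of_core {A B : MaxClique G} (hZ : Z ∈ D)
    (h : (cliqueGraph G).Adj A B) (hA : A ∈ core D Z) (hB : B ∈ D) (hB' : B ∉ core D Z) :
    IsMinWeightEdge (cliqueGraphOn D) s(A, B) := by
  by_contra hcon
  refine hB' (hA.trans (SimpleGraph.Adj.reachable ?_))
  exact heavyGraph_adj.mpr ⟨⟨h, core_subset hZ hA, hB⟩, hcon⟩

lemma isCriticalEdge_of_core {A B : MaxClique G} (hZ : Z ∈ D)
    (h : (cliqueGraph G).Adj A B) (hA : A ∈ core D Z) (hB : B ∈ D) (hB' : B ∉ core D Z) :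
    IsCriticalEdge (cliqueGraphOn D) Z s(A, B) :=
  ⟨isMinWeightEdge_of_core hZ h hA hB hB', A, by simp, hA⟩

lemma IsCriticalEdge.exists_core [Finite V] {e : Sym2 (MaxClique G)}
    (h : IsCriticalEdge (cliqueGraphOn D) Z e) :
    ∃ A B, e = s(A, B) ∧ (cliqueGraph G).Adj A B ∧ A ∈ core D Z ∧ B ∈ D ∧ B ∉ core D Z := by
  obtain ⟨hmin, A, hAe, hA⟩ := h
  obtain ⟨B, rfl⟩ := Sym2.mem_iff_exists.mp hAe
  obtain ⟨h1, h2, h3⟩ := hmin.1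
  exact ⟨A, B, rfl, h1, hA, h3, fun hB => not_isMinWeightEdge_of_mem_core h1 hA hB hmin⟩

lemma IsCriticalLabel.exists_core [Finite V]
    (h : IsCriticalLabel (cliqueGraphOn D) Z S) :
    ∃ A B, (cliqueGraph G).Adj A B ∧ A ∈ core D Z ∧ B ∈ D ∧ B ∉ core D Z ∧ A.1 ∩ B.1 = S ∧
      IsMinWeightEdge (cliqueGraphOn D) s(A, B) := by
  obtain ⟨⟨e, he⟩, hS⟩ := h
  obtain ⟨A, B, rfl, h1, h2, h3, h4⟩ := he.exists_core
  exact ⟨A, B, h1, h2, h3, h4, hS _ he, he.1⟩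

lemma IsCriticalLabel.label_eq {A B : MaxClique G} (h : IsCriticalLabel (cliqueGraphOn D) Z S)
    (hZ : Z ∈ D) (hAB : (cliqueGraph G).Adj A B) (hA : A ∈ core D Z) (hB : B ∈ D)
    (hB' : B ∉ core D Z) : A.1 ∩ B.1 = S :=
  h.2 _ (isCriticalEdge_of_core hZ hAB hA hB hB')

lemma IsCriticalLabel.unique {H : SimpleGraph (MaxClique G)} {S' : Set V}
    (h : IsCriticalLabel H Z S) (h' : IsCriticalLabel H Z S') : S = S' := by
  obtain ⟨e, he⟩ := h.1
  rw [← h.2 e he, ← h'.2 e he]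

lemma IsCriticalLabel.core_subset_sepComp [Finite V]
    (h : IsCriticalLabel (cliqueGraphOn D) Z S) : core D Z ⊆ sepComp S Z := by
  obtain ⟨e, he⟩ := h.1
  rw [← h.2 e he]
  exact PrimEnd.core_subset_sepComp he.1

lemma isBlock_univ [Finite V] (hG : IsChordal G) : IsBlock (Set.univ : Set (MaxClique G)) Z where
  mem := trivial
  conn K _ := by
    rw [cliqueGraphOn_univ]
    refine (hG.reachable_labelGraph_inter Z K).mono ?_
    intro A B h
    exact h.1
  lt _ _ _ _ _ _ _ _ _ h := (h trivial).elim

lemma IsBlock.core [Finite V] (hD : IsBlock D Z) : IsBlock (core D Z) Z where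
  mem := self_mem_core
  conn K hK := by
    refine (reachable_induction (P := fun K => K ∈ PrimEnd.core D Z ∧
      (cliqueGraphOn (PrimEnd.core D Z)).Reachable Z K) hK ⟨self_mem_core, by rfl⟩ ?_).2
    rintro u w h ⟨hu, hr⟩
    have hw : w ∈ PrimEnd.core D Z := SimpleGraph.Reachable.trans hu h.reachable
    exact ⟨hw, hr.trans (SimpleGraph.Adj.reachable ⟨(heavyGraph_adj.mp h).1.1, hu, hw⟩)⟩
  lt P Q R U hPQ hP hQ hRU hR hU := by
    have hsub := core_subset hD.mem
    by_cases hUD : U ∈ D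
    · have h1 := isMinWeightEdge_of_core hD.mem hRU hR hUD hU
      refine lt_of_le_of_ne (h1.le hPQ (hsub hP) (hsub hQ)) fun h => ?_
      exact not_isMinWeightEdge_of_mem_core hPQ hP hQ
        ⟨⟨hPQ, hsub hP, hsub hQ⟩, fun f hf => h ▸ h1.2 f hf⟩
    · exact hD.lt P Q R U hPQ (hsub hP) (hsub hQ) hRU (hsub hR) hUD

/-- A block with two cliques is larger than its core. -/
lemma IsBlock.exists_notMem_core [Finite V] (hD : IsBlock D Z) {K : MaxClique G} (hK : K ∈ D)
    (hKZ : K ≠ Z) : ∃ B ∈ D, B ∉ PrimEnd.core D Z := by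
  have hedge : ∃ e, e ∈ (cliqueGraphOn D).edgeSet := by
    obtain ⟨p⟩ := hD.conn K hK
    cases p with
    | nil => exact (hKZ rfl).elim
    | @cons _ B _ h _ => exact ⟨s(Z, B), h⟩
  obtain ⟨e, he, hmin⟩ := (Set.toFinite (cliqueGraphOn D).edgeSet).exists_minimalFor weight _ hedge
  induction e with | _ A B
  have hAB : IsMinWeightEdge (cliqueGraphOn D) s(A, B) :=
    ⟨he, fun f hf => (le_total (weight s(A, B)) (weight f)).elim id fun h => hmin hf h⟩
  by_contra! hcon
  exact not_isMinWeightEdge_of_mem_core he.1 (hcon A he.2.1) (hcon B he.2.2) hAB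

lemma IsBlock.exists_boundary (hD : IsBlock D Z) {X : MaxClique G} (hX : X ∈ D)
    (hX' : X ∉ PrimEnd.core D Z) : ∃ A B, (cliqueGraph G).Adj A B ∧ A ∈ PrimEnd.core D Z ∧
      B ∈ D ∧ B ∉ PrimEnd.core D Z ∧
      (cliqueGraphOn (D \ PrimEnd.core D Z)).Reachable X B := by
  by_contra! hcon
  refine (reachable_induction (P := fun u => u ∈ D \ PrimEnd.core D Z ∧
    (cliqueGraphOn (D \ PrimEnd.core D Z)).Reachable X u) (hD.conn X hX).symm
    ⟨⟨hX, hX'⟩, by rfl⟩ ?_).1.2 self_mem_core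
  rintro u w h ⟨hu, hr⟩
  have hw : w ∈ D \ PrimEnd.core D Z :=
    ⟨h.2.2, fun hw => hcon w u h.1.symm hw hu.1 hu.2 hr⟩
  exact ⟨hw, hr.trans (SimpleGraph.Adj.reachable ⟨h.1, hu, hw⟩)⟩

lemma IsChordal.reachable_of_not_inter_subset [Finite V] (hG : IsChordal G) {A B : MaxClique G}
    (h : ¬ A.1 ∩ B.1 ⊆ S) : (cliqueGraphMinus G S).Reachable A B := by
  refine (hG.reachable_labelGraph_inter A B).mono fun X Y hXY => ?_
  exact cliqueGraphMinus_adj.mpr ⟨hXY.1, fun hle => h (hXY.2.trans hle)⟩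

/-- Two maximal cliques containing `S` that `S` separates are adjacent, with label `S`. -/
lemma IsChordal.adj_of_subset [Finite V] (hG : IsChordal G) {A B : MaxClique G} (hA : S ⊆ A.1)
    (hB : S ⊆ B.1) (h : ¬ (cliqueGraphMinus G S).Reachable A B) :
    (cliqueGraph G).Adj A B ∧ A.1 ∩ B.1 = S := by
  have hS : A.1 ∩ B.1 = S := by
    refine subset_antisymm ?_ (Set.subset_inter hA hB)
    by_contra hcon
    exact h (hG.reachable_of_not_inter_subset hcon)
  exact ⟨hG.adj_of_not_reachable (by rwa [hS]), hS⟩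

/-- If all critical edges of a block have the same label, then the block stays connected when its
core is removed. -/
lemma IsBlock.reachable_diff_core [Finite V] (hG : IsChordal G) (hD : IsBlock D Z)
    (hS : IsCriticalLabel (cliqueGraphOn D) Z S) {X Y : MaxClique G} (hX : X ∈ D)
    (hX' : X ∉ PrimEnd.core D Z) (hY : Y ∈ D) (hY' : Y ∉ PrimEnd.core D Z) :
    (cliqueGraphOn (D \ PrimEnd.core D Z)).Reachable X Y := by
  obtain ⟨A, B, hAB, hA, hB, hB', hr⟩ := hD.exists_boundary hX hX'
  obtain ⟨A', B', hAB', hA', hB₁, hB₁', hr'⟩ := hD.exists_boundary hY hY'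
  refine hr.trans (SimpleGraph.Reachable.trans ?_ hr'.symm)
  have hl := hS.label_eq hD.mem hAB hA hB hB'
  have hl' := hS.label_eq hD.mem hAB' hA' hB₁ hB₁'
  have hSB : S ⊆ B.1 := hl ▸ Set.inter_subset_right
  have hSB' : S ⊆ B'.1 := hl' ▸ Set.inter_subset_right
  by_cases hBB : (cliqueGraphMinus G S).Reachable B B'
  · refine (reachable_induction (P := fun u => u ∈ D \ PrimEnd.core D Z ∧
      (cliqueGraphOn (D \ PrimEnd.core D Z)).Reachable B u)
      (hG.reachable_labelGraph_of_reachable hBB) ⟨⟨hB, hB'⟩, by rfl⟩ ?_).2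
    rintro u w ⟨huw, hnot, hsub⟩ ⟨hu, hur⟩
    have hSuw : S ⊆ u.1 ∩ w.1 := (Set.subset_inter hSB hSB').trans hsub
    have hwD : w ∈ D := by
      by_contra hwD
      have h1 := hD.lt A B u w hAB (core_subset hD.mem hA) hB huw hu.1 hwD
      have h2 : weight s(A, B) ≤ weight s(u, w) :=
        Set.ncard_le_ncard (hl ▸ hSuw : A.1 ∩ B.1 ⊆ _) (Set.toFinite _)
      omega
    have hw : w ∉ PrimEnd.core D Z := fun hw => hnot (by
      rw [Set.inter_comm, hS.label_eq hD.mem huw.symm hw hu.1 hu.2])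
    exact ⟨⟨hwD, hw⟩, hur.trans (SimpleGraph.Adj.reachable ⟨huw, hu, hwD, hw⟩)⟩
  · exact SimpleGraph.Adj.reachable ⟨(hG.adj_of_subset hSB hSB' hBB).1, ⟨hB, hB'⟩, hB₁, hB₁'⟩

/-- If a block with two cliques stays connected when its core is removed, then all its critical
edges have the same label. -/
lemma IsBlock.exists_isCriticalLabel [Finite V] (hG : IsChordal G) (hD : IsBlock D Z)
    {K : MaxClique G} (hK : K ∈ D) (hKZ : K ≠ Z)
    (hconn : ∀ X ∈ D, X ∉ PrimEnd.core D Z → ∀ Y ∈ D, Y ∉ PrimEnd.core D Z →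
      (cliqueGraphOn (D \ PrimEnd.core D Z)).Reachable X Y) :
    ∃ S, IsCriticalLabel (cliqueGraphOn D) Z S := by
  obtain ⟨X, hX, hX'⟩ := hD.exists_notMem_core hK hKZ
  obtain ⟨A, B, hAB, hA, hB, hB', -⟩ := hD.exists_boundary hX hX'
  have hmin := isMinWeightEdge_of_core hD.mem hAB hA hB hB'
  refine ⟨A.1 ∩ B.1, ⟨_, isCriticalEdge_of_core hD.mem hAB hA hB hB'⟩, fun e he => ?_⟩
  obtain ⟨A', B', rfl, hAB', hA', hB₁, hB₁'⟩ := he.exists_core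
  change A'.1 ∩ B'.1 = A.1 ∩ B.1
  by_contra hne
  have hnot : ¬ A'.1 ∩ B'.1 ⊆ A.1 ∩ B.1 := fun hsub =>
    hne (Set.eq_of_subset_of_ncard_le hsub (hmin.2 _ he.1.1) (Set.toFinite _))
  have hAB'r : (cliqueGraphMinus G (A.1 ∩ B.1)).Reachable A B' :=
    ((hA.symm.trans hA').mono (heavyGraph_le hmin)).trans
      (cliqueGraphMinus_adj.mpr ⟨hAB', hnot⟩).reachable
  -- on the way from `B` to `B'` outside the core, some edge enters the component of `A`
  have hcross : ∃ X Y, (cliqueGraphOn (D \ PrimEnd.core D Z)).Adj X Y ∧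
      ¬ (cliqueGraphMinus G (A.1 ∩ B.1)).Reachable A X ∧
      (cliqueGraphMinus G (A.1 ∩ B.1)).Reachable A Y := by
    by_contra! hcon
    exact reachable_induction (P := fun u => ¬ (cliqueGraphMinus G (A.1 ∩ B.1)).Reachable A u)
      (hconn B hB hB' B' hB₁ hB₁') (not_reachable_of_adj hAB) hcon hAB'r
  obtain ⟨X, Y, ⟨hXY, hXD, hYD⟩, hAX, hAY⟩ := hcross
  have hXYS : X.1 ∩ Y.1 = A.1 ∩ B.1 := by
    have hsub : X.1 ∩ Y.1 ⊆ A.1 ∩ B.1 := by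
      by_contra hcon
      exact hAX (hAY.trans (cliqueGraphMinus_adj.mpr ⟨hXY, hcon⟩).reachable.symm)
    exact Set.eq_of_subset_of_ncard_le hsub (hmin.le hXY hXD.1 hYD.1) (Set.toFinite _)
  have hSY : A.1 ∩ B.1 ⊆ A.1 ∩ Y.1 :=
    Set.subset_inter Set.inter_subset_left (hXYS ▸ Set.inter_subset_right)
  refine hYD.2 (reachable_induction (P := fun u => u ∈ PrimEnd.core D Z)
    (hG.reachable_labelGraph_of_reachable hAY) hA ?_)
  rintro u w ⟨huw, hnuw, hsub⟩ hu
  have hSuw := hSY.trans hsub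
  have hlt : weight s(A, B) < weight s(u, w) := Set.ncard_lt_ncard ⟨hSuw, hnuw⟩ (Set.toFinite _)
  by_contra hw
  by_cases hwD : w ∈ D
  · have := (isMinWeightEdge_of_core hD.mem huw hu hwD hw).le hAB (core_subset hD.mem hA) hB
    omega
  · have := hD.lt A B u w hAB (core_subset hD.mem hA) hB huw (core_subset hD.mem hu) hwD
    omega

/-- When the whole clique graph has a critical label `S`, its core is the `Z`-component of
`C(G) - S`. -/
lemma sepComp_eq_core_univ [Finite V]
    (hS : IsCriticalLabel (cliqueGraph G) Z S) : sepComp S Z = core Set.univ Z := by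
  rw [← cliqueGraphOn_univ] at hS
  refine subset_antisymm (fun K hK => ?_) hS.core_subset_sepComp
  refine reachable_induction hK self_mem_core fun u w h hu => ?_
  obtain ⟨huw, hnot⟩ := cliqueGraphMinus_adj.mp h
  by_contra hw
  exact hnot (hS.label_eq trivial huw hu trivial hw).subset

/-- Let the block `D` be the `Z`-component of `C(G) - S₀` and let `S` be its critical label. If a
clique of `D` outside the core contains `S₀`, then the core is the `Z`-component of `C(G) - S`. -/
lemma IsBlock.sepComp_eq_core [Finite V] (hG : IsChordal G) {S₀ : Set V}
    (hD : IsBlock (sepComp S₀ Z) Z)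
    (hS : IsCriticalLabel (cliqueGraphOn (sepComp S₀ Z)) Z S)
    {A : MaxClique G} (hA : A ∈ sepComp S₀ Z) (hA' : A ∉ PrimEnd.core (sepComp S₀ Z) Z)
    (hSA : S₀ ⊆ A.1) : sepComp S Z = PrimEnd.core (sepComp S₀ Z) Z := by
  refine subset_antisymm (fun K hK => ?_) hS.core_subset_sepComp
  refine reachable_induction hK self_mem_core fun u w h hu => ?_
  obtain ⟨huw, hnot⟩ := cliqueGraphMinus_adj.mp h
  have huD := core_subset hD.mem hu
  by_cases hwD : w ∈ sepComp S₀ Z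
  · by_contra hw
    exact hnot (hS.label_eq hD.mem huw hu hwD hw).subset
  · exfalso
    have hT : u.1 ∩ w.1 ⊆ S₀ := by
      by_contra hcon
      exact hwD (huD.trans (cliqueGraphMinus_adj.mpr ⟨huw, hcon⟩).reachable)
    refine hA' (reachable_induction (P := fun x => x ∈ PrimEnd.core (sepComp S₀ Z) Z)
      (hG.reachable_labelGraph_of_reachable (huD.symm.trans hA)) hu ?_)
    rintro x y ⟨hxy, hnxy, hsub⟩ hx
    by_contra hy
    have hyD : y ∈ sepComp S₀ Z := (core_subset hD.mem hx).trans
      (cliqueGraphMinus_adj.mpr ⟨hxy, hnxy⟩).reachable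
    rw [hS.label_eq hD.mem hxy hx hyD hy] at hsub
    exact hnot ((Set.subset_inter Set.inter_subset_left (hT.trans hSA)).trans hsub)

lemma componentOf_cliqueGraphMinus :
    componentOf (cliqueGraphMinus G S) Z = cliqueGraphOn (sepComp S Z) := by
  ext A B
  constructor
  · rintro ⟨h, hA⟩
    exact ⟨(cliqueGraphMinus_adj.mp h).1, hA, hA.trans h.reachable⟩
  · rintro ⟨h, hA, hB⟩
    refine ⟨cliqueGraphMinus_adj.mpr ⟨h, fun hle => ?_⟩, hA⟩
    refine not_reachable_of_adj h ((hA.symm.trans hB).mono fun X Y hXY => ?_)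
    obtain ⟨h1, h2⟩ := cliqueGraphMinus_adj.mp hXY
    exact cliqueGraphMinus_adj.mpr ⟨h1, fun h3 => h2 (h3.trans hle)⟩

end Blocks

/-! ### The clique of a simplicial vertex -/

section Simplicial

variable {V : Type*} {G : SimpleGraph V} {z : V} (hz : IsSimplicial G z)

lemma MaxClique.subset_closedNbhd (K : MaxClique G) {v : V} (hv : v ∈ K.1) :
    K.1 ⊆ closedNbhd G v := by
  intro x hx
  by_cases hxv : x = v
  · exact Or.inl hxv
  · exact Or.inr (K.adj hv hx (Ne.symm hxv))

lemma MaxClique.eq_of_isSimplicial {K K' : MaxClique G} {v : V} (hv : IsSimplicial G v)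
    (h : v ∈ K.1) (h' : v ∈ K'.1) : K = K' := by
  rw [MaxClique.eq_of_subset (K' := nbhdClique hv) (K.subset_closedNbhd h),
    MaxClique.eq_of_subset (K' := nbhdClique hv) (K'.subset_closedNbhd h')]

lemma label_subset_nonsimplicial {K : MaxClique G}
    (h : (cliqueGraph G).Adj (nbhdClique hz) K) :
    (nbhdClique hz).1 ∩ K.1 ⊆ {v ∈ closedNbhd G z | ¬ IsSimplicial G v} :=
  fun _ hv => ⟨hv.1, fun hs => h.ne (MaxClique.eq_of_isSimplicial hs hv.1 hv.2)⟩

lemma sepComp_nonsimplicial :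
    sepComp {v ∈ closedNbhd G z | ¬ IsSimplicial G v} (nbhdClique hz) = {nbhdClique hz} := by
  refine subset_antisymm (fun K hK => ?_) ?_
  · refine reachable_induction (P := fun K => K = nbhdClique hz) hK rfl ?_
    rintro u w h rfl
    obtain ⟨h1, h2⟩ := cliqueGraphMinus_adj.mp h
    exact (h2 (label_subset_nonsimplicial hz h1)).elim
  · rintro _ rfl
    exact SimpleGraph.Reachable.refl _

lemma exists_maxClique_ne_of_not_isSimplicial [Finite V] {v : V} (hv : ¬ IsSimplicial G v)
    (K : MaxClique G) : ∃ K' : MaxClique G, K' ≠ K ∧ v ∈ K'.1 := by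
  by_contra! hcon
  refine hv (K.2.1.subset fun a ha => ?_)
  have hcl : G.IsClique {v, a} := by
    rw [SimpleGraph.isClique_pair]
    rintro hne
    exact ha.resolve_left (Ne.symm hne)
  obtain ⟨M, hM⟩ := exists_maxClique_superset hcl
  by_cases hMK : M = K
  · exact hMK ▸ hM (by simp)
  · exact (hcon M hMK (hM (by simp))).elim

/-- If the label `S` of an edge at `N[z]` isolates `N[z]` in `C(G) - S`, then it consists of all
non-simplicial vertices of `N[z]`. -/
lemma IsChordal.eq_nonsimplicial [Finite V] (hG : IsChordal G) {S : Set V} {K : MaxClique G}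
    (hK : (cliqueGraph G).Adj (nbhdClique hz) K) (hS : (nbhdClique hz).1 ∩ K.1 = S)
    (h : sepComp S (nbhdClique hz) = {nbhdClique hz}) :
    S = {v ∈ closedNbhd G z | ¬ IsSimplicial G v} := by
  refine subset_antisymm (hS ▸ label_subset_nonsimplicial hz hK) ?_
  rintro v ⟨hv, hvs⟩
  obtain ⟨K', hne, hvK'⟩ := exists_maxClique_ne_of_not_isSimplicial hvs (nbhdClique hz)
  by_contra hvS
  have hr : K' ∈ sepComp S (nbhdClique hz) :=
    hG.reachable_of_not_inter_subset fun hle => hvS (hle ⟨hv, hvK'⟩)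
  rw [h] at hr
  exact hne hr

end Simplicial

/-! ### Construction of Prim orderings -/

section Construction

variable {V : Type*} {G : SimpleGraph V}

/-- `B` is a clique that a Prim traversal may visit next when it has visited the set `R`. -/
def IsPrimStep (R : Set (MaxClique G)) (B : MaxClique G) : Prop :=
  B ∉ R ∧ ∃ A ∈ R, (cliqueGraph G).Adj A B ∧
    ∀ X ∈ R, ∀ Y, Y ∉ R → (cliqueGraph G).Adj X Y → weight s(X, Y) ≤ weight s(A, B)

/-- `f` numbers the cliques in `R` from `0` in the order of a Prim traversal that starts at `K` and
has visited exactly `R`. The values of `f` outside `R` are irrelevant. -/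
structure IsPrimNumbering (f : MaxClique G → ℕ) (K : MaxClique G) (R : Set (MaxClique G)) :
    Prop where
  mem : K ∈ R
  start : f K = 0
  lt : ∀ X ∈ R, f X < R.ncard
  inj : R.InjOn f
  prim : ∀ B ∈ R, 0 < f B → ∃ A ∈ R, f A < f B ∧ (cliqueGraph G).Adj A B ∧
    ∀ X Y, X ∈ R → f X < f B → (Y ∈ R → f B ≤ f Y) → (cliqueGraph G).Adj X Y →
      weight s(X, Y) ≤ weight s(A, B)

/-- `R` is the set visited at some moment of a Prim traversal that starts at `K`. -/
def IsPrimVisited (K : MaxClique G) (R : Set (MaxClique G)) : Prop :=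
  ∃ f, IsPrimNumbering f K R

variable {K Z : MaxClique G} {R : Set (MaxClique G)}

lemma isPrimVisited_singleton : IsPrimVisited K {K} :=
  ⟨fun _ => 0, ⟨rfl, rfl, by simp, by simp, fun _ _ h => (lt_irrefl _ h).elim⟩⟩

open Classical in
lemma IsPrimNumbering.insert_step [Finite V] {f : MaxClique G → ℕ} {B : MaxClique G}
    (h : IsPrimNumbering f K R) (hB : IsPrimStep R B) :
    IsPrimNumbering (Function.update f B R.ncard) K (insert B R) := by
  obtain ⟨hBR, A, hA, hAB, hmax⟩ := hB
  have hf : ∀ X ∈ R, Function.update f B R.ncard X = f X := fun X hX =>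
    Function.update_of_ne (by rintro rfl; exact hBR hX) _ _
  have hfB : Function.update f B R.ncard B = R.ncard := Function.update_self _ _ _
  refine ⟨Set.mem_insert_of_mem _ h.mem, by rw [hf _ h.mem, h.start], ?_, ?_, ?_⟩
  · rw [Set.ncard_insert_of_notMem hBR (Set.toFinite _)]
    rintro X (rfl | hX)
    · rw [hfB]; omega
    · rw [hf X hX]; exact (h.lt X hX).trans (Nat.lt_succ_self _)
  · rintro X (rfl | hX) Y (rfl | hY) hXY
    · rfl
    · rw [hfB, hf Y hY] at hXY
      exact absurd (h.lt Y hY) (by omega)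
    · rw [hfB, hf X hX] at hXY
      exact absurd (h.lt X hX) (by omega)
    · rw [hf X hX, hf Y hY] at hXY
      exact h.inj hX hY hXY
  · rintro B' (rfl | hB') hpos
    · rw [hfB]
      refine ⟨A, Set.mem_insert_of_mem _ hA, by rw [hf A hA]; exact h.lt A hA, hAB, ?_⟩
      rintro X Y (rfl | hX) hlt hY hXY
      · rw [hfB] at hlt
        exact (lt_irrefl _ hlt).elim
      · refine hmax X hX Y (fun hYR => ?_) hXY
        have := hY (Set.mem_insert_of_mem _ hYR)
        rw [hf Y hYR] at this
        exact absurd (h.lt Y hYR) (by omega)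
    · rw [hf B' hB'] at hpos ⊢
      obtain ⟨A', hA', hlt, hadj, hmax'⟩ := h.prim B' hB' hpos
      refine ⟨A', Set.mem_insert_of_mem _ hA', by rwa [hf A' hA'], hadj, ?_⟩
      rintro X Y (rfl | hX) hlt' hY hXY
      · rw [hfB] at hlt'
        exact absurd (h.lt B' hB') (by omega)
      · rw [hf X hX] at hlt'
        refine hmax' X Y hX hlt' (fun hYR => ?_) hXY
        have := hY (Set.mem_insert_of_mem _ hYR)
        rwa [hf Y hYR] at this

lemma IsPrimVisited.insert_step [Finite V] {B : MaxClique G} (h : IsPrimVisited K R)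
    (hB : IsPrimStep R B) : IsPrimVisited K (insert B R) := by
  obtain ⟨f, hf⟩ := h
  exact ⟨_, hf.insert_step hB⟩

/-- A Prim traversal that has visited all cliques but `Z` yields a Prim ordering ending with `Z`. -/
lemma IsPrimVisited.exists_isPrimOrdering [Finite V] (hG : IsChordal G)
    (h : IsPrimVisited K {Z}ᶜ) :
    ∃ π : CliqueOrdering G, IsPrimOrdering π ∧ StartsWith π K ∧ EndsWith π Z := by
  classical
  obtain ⟨f, hf⟩ := h
  have hstep : IsPrimStep {Z}ᶜ Z := by
    refine ⟨by simp, ?_⟩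
    have hne : ({A | (cliqueGraph G).Adj A Z}).Nonempty := by
      obtain ⟨p⟩ := hG.reachable_labelGraph_inter Z K
      cases p with
      | nil => exact (hf.mem rfl).elim
      | @cons _ B _ h _ => exact ⟨B, h.1.symm⟩
    obtain ⟨A, hA, hmax⟩ :=
      (Set.toFinite {A | (cliqueGraph G).Adj A Z}).exists_maximalFor
        (fun A => weight s(A, Z)) _ hne
    refine ⟨A, SimpleGraph.Adj.ne (G := cliqueGraph G) hA, hA, fun X _ Y hY hXY => ?_⟩
    obtain rfl : Y = Z := by simpa using hY
    exact (le_total _ _).elim id fun h => hmax hXY h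
  have hn := hf.insert_step hstep
  have hfZ : Function.update f Z ({Z}ᶜ : Set (MaxClique G)).ncard Z =
    ({Z}ᶜ : Set (MaxClique G)).ncard := Function.update_self _ _ _
  generalize Function.update f Z ({Z}ᶜ : Set (MaxClique G)).ncard = g at hn hfZ
  have huniv : insert Z ({Z}ᶜ : Set (MaxClique G)) = Set.univ := by
    ext X; simp [Set.mem_insert_iff, em]
  have hcard : ({Z}ᶜ : Set (MaxClique G)).ncard + 1 = Nat.card (MaxClique G) := by
    rw [← Set.ncard_insert_of_notMem (a := Z) (by simp) (Set.toFinite _), huniv, Set.ncard_univ]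
  rw [huniv] at hn
  have hlt : ∀ X, g X < Nat.card (MaxClique G) := fun X => by
    have := hn.lt X trivial
    rwa [Set.ncard_univ] at this
  let F : MaxClique G → Fin (Nat.card (MaxClique G)) := fun X => ⟨g X, hlt X⟩
  have hF : Function.Bijective F := by
    refine Function.Injective.bijective_of_nat_card_le (fun X Y h => ?_) (by simp)
    exact hn.inj trivial trivial (by simpa [F] using h)
  refine ⟨Equiv.ofBijective F hF, ?_, hn.start, ?_⟩
  · intro B hB
    obtain ⟨A, -, h1, h2, h3⟩ := hn.prim B trivial hB
    exact ⟨A, h1, h2, fun X Y hX hY hXY => h3 X Y trivial hX (fun _ => hY) hXY⟩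
  · change g Z + 1 = _
    rw [hfZ, hcard]

/-- A Prim traversal that has visited a clique of a connected set `E` may go on to visit all of `E`
if no other edge it could use is heavier than an edge inside `E`. -/
lemma IsPrimVisited.union [Finite V] {R : Set (MaxClique G)} (h : IsPrimVisited K R)
    {E : Set (MaxClique G)} {c : ℕ}
    (hRE : (R ∩ E).Nonempty)
    (hconn : ∀ X ∈ E, ∀ Y ∈ E, (cliqueGraphOn E).Reachable X Y)
    (hin : ∀ X ∈ E, ∀ Y ∈ E, (cliqueGraph G).Adj X Y → c ≤ weight s(X, Y))
    (hout : ∀ X ∈ R ∪ E, ∀ Y, Y ∉ R → (cliqueGraph G).Adj X Y → ¬ (X ∈ E ∧ Y ∈ E) →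
      weight s(X, Y) ≤ c) : IsPrimVisited K (R ∪ E) := by
  by_cases hER : E ⊆ R
  · rwa [Set.union_eq_self_of_subset_right hER]
  obtain ⟨Y₀, hY₀, hY₀R⟩ := Set.not_subset.mp hER
  obtain ⟨X₀, hX₀R, hX₀⟩ := hRE
  have hne : ({p : MaxClique G × MaxClique G | (cliqueGraphOn E).Adj p.1 p.2 ∧ p.1 ∈ R ∧
      p.2 ∉ R}).Nonempty := by
    by_contra! hcon
    refine hY₀R (reachable_induction (P := fun u => u ∈ R) (hconn X₀ hX₀ Y₀ hY₀) hX₀R ?_)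
    intro u w huw hu
    by_contra hw
    exact (Set.eq_empty_iff_forall_notMem.mp hcon (u, w)) ⟨huw, hu, hw⟩
  obtain ⟨⟨A, B⟩, ⟨⟨hAB, hA, hB⟩, hAR, hBR⟩, hmax⟩ :=
    (Set.toFinite _).exists_maximalFor (fun p => weight s(p.1, p.2)) _ hne
  dsimp only at hAB hA hB hAR hBR hmax
  have hstep : IsPrimStep R B := by
    refine ⟨hBR, A, hAR, hAB, fun X hX Y hY hXY => ?_⟩
    by_cases hXYE : X ∈ E ∧ Y ∈ E
    · exact (le_total _ _).elim id fun h =>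
        hmax (j := (X, Y)) ⟨⟨hXY, hXYE⟩, hX, hY⟩ h
    · exact (hout X (Or.inl hX) Y hY hXY hXYE).trans (hin A hA B hB hAB)
  have hunion : insert B R ∪ E = R ∪ E := by
    rw [Set.insert_union]
    exact Set.insert_eq_of_mem (Or.inr hB)
  rw [← hunion]
  refine IsPrimVisited.union (h.insert_step hstep) ⟨X₀, Or.inr hX₀R, hX₀⟩ hconn hin ?_
  rw [hunion]
  exact fun X hX Y hY => hout X hX Y fun hYR => hY (Or.inr hYR)
termination_by (E \ R).ncard
decreasing_by
  refine Set.ncard_lt_ncard ⟨fun X hX => ⟨hX.1, fun h => hX.2 (Or.inr h)⟩, fun hle => ?_⟩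
    (Set.toFinite _)
  exact (hle ⟨hB, hBR⟩).2 (Or.inl rfl)

/-- A Prim traversal that enters a block at a clique outside its core can visit all cliques outside
the core before it enters the core. -/
lemma IsPrimVisited.compl_core [Finite V] (hG : IsChordal G) {D : Set (MaxClique G)} {S : Set V}
    (hD : IsBlock D Z) (hS : IsCriticalLabel (cliqueGraphOn D) Z S) {A : MaxClique G} (hA : A ∈ D)
    (hA' : A ∉ core D Z) (h : IsPrimVisited K (insert A Dᶜ)) : IsPrimVisited K (core D Z)ᶜ := by
  have hsub := core_subset hD.mem
  obtain ⟨P, Q, hPQ, hP, hQ, hQ', -, hmin⟩ := hS.exists_core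
  have hunion : (core D Z)ᶜ = insert A Dᶜ ∪ (D \ core D Z) := by
    ext X
    simp only [Set.mem_compl_iff, Set.mem_union, Set.mem_insert_iff, Set.mem_sdiff]
    constructor
    · intro hX
      by_cases hXD : X ∈ D
      · exact Or.inr ⟨hXD, hX⟩
      · exact Or.inl (Or.inr hXD)
    · rintro ((rfl | hX) | hX)
      · exact hA'
      · exact fun h => hX (hsub h)
      · exact hX.2
  rw [hunion]
  refine h.union (c := weight s(P, Q)) ⟨A, Or.inl rfl, hA, hA'⟩
    (fun X hX Y hY => hD.reachable_diff_core hG hS hX.1 hX.2 hY.1 hY.2)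
    (fun X hX Y hY hXY => hmin.le hXY hX.1 hY.1) ?_
  rw [← hunion]
  intro X hX Y hY hXY hnot
  have hYD : Y ∈ D := by
    by_contra hYD
    exact hY (Or.inr hYD)
  by_cases hXD : X ∈ D
  · have hYc : Y ∈ core D Z := by
      by_contra hYc
      exact hnot ⟨⟨hXD, hX⟩, hYD, hYc⟩
    rw [Sym2.eq_swap]
    exact (isMinWeightEdge_of_core hD.mem hXY.symm hYc hXD hX).le hPQ (hsub hP) hQ
  · rw [Sym2.eq_swap]
    exact (hD.lt P Q Y X hPQ (hsub hP) hQ hXY.symm hYD hXD).le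

end Construction

/-! ### Sequences of critical labels -/

section Levels

variable {V : Type*} {G : SimpleGraph V}

/-- The sets on which the labels `S 0, S 1, …` are required to be critical: all maximal cliques
for `S 0`, and the `Z`-component of `C(G) - S i` for `S (i + 1)`. -/
def level (S : ℕ → Set V) (Z : MaxClique G) : ℕ → Set (MaxClique G)
  | 0 => Set.univ
  | i + 1 => sepComp (S i) Z

variable {S : ℕ → Set V} {Z : MaxClique G} {m : ℕ}

/-- The labels are distinct: each of them determines the next one, and the last one isolates `Z`,
after which there is no critical edge. -/
lemma criticalLabels_injective
    (hcrit : ∀ i ≤ m, IsCriticalLabel (cliqueGraphOn (level S Z i)) Z (S i))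
    (hlast : level S Z (m + 1) = {Z}) (d : ℕ) :
    ∀ i j, i < j → j + d = m → S i ≠ S j := by
  induction d with
  | zero =>
    rintro i j hij rfl heq
    have h : level S Z (i + 1) = {Z} := by
      rw [← hlast]
      change sepComp _ _ = sepComp _ _
      rw [heq]
    obtain ⟨⟨e, he⟩, -⟩ := hcrit (i + 1) (by omega)
    rw [h] at he
    induction e with | _ A B
    obtain ⟨hAB, hA, hB⟩ := he.1.1
    exact hAB.ne (hA.trans hB.symm)
  | succ d ih =>
    intro i j hij hj heq
    refine ih (i + 1) (j + 1) (by omega) (by omega) ?_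
    have h : level S Z (i + 1) = level S Z (j + 1) := by
      change sepComp _ _ = sepComp _ _
      rw [heq]
    have h1 := hcrit (i + 1) (by omega)
    rw [h] at h1
    exact h1.unique (hcrit (j + 1) (by omega))

/-- If the levels up to `i + 1` are successive cores of blocks, then level `i + 1` can be entered
outside its core: some clique there contains `S i`. Otherwise the component of `C(G) - S (i + 1)`
would extend beyond level `i + 1`, and the lightest edges of this extension, whose label is an
earlier `S j`, would be critical once more. -/
lemma exists_entrance [Finite V]
    (hcrit : ∀ i ≤ m, IsCriticalLabel (cliqueGraphOn (level S Z i)) Z (S i))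
    (hlast : level S Z (m + 1) = {Z}) {i : ℕ} (hi : i + 1 ≤ m)
    (h : ∀ j ≤ i, IsBlock (level S Z j) Z ∧ level S Z (j + 1) = core (level S Z j) Z) :
    ∃ A ∈ level S Z (i + 1), A ∉ core (level S Z (i + 1)) Z ∧ S i ⊆ A.1 := by
  classical
  by_contra! hcon
  have hnsub : ¬ S i ⊆ S (i + 1) := by
    obtain ⟨X, Y, -, -, hY, hY', hXY, -⟩ := (hcrit (i + 1) hi).exists_core
    exact fun hsub => hcon Y hY hY' (hsub.trans (hXY ▸ Set.inter_subset_right))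
  obtain ⟨A, B, hAB, hA, hB, hB', hSi, -⟩ := (hcrit i (by omega)).exists_core
  rw [← (h i le_rfl).2] at hA hB'
  have hZ : ∀ j, Z ∈ level S Z j
    | 0 => trivial
    | _ + 1 => SimpleGraph.Reachable.refl _
  -- the edge `AB` with label `S i` survives in `C(G) - S (i + 1)`
  have hAE : A ∈ level S Z (i + 2) := by
    refine (hcrit (i + 1) hi).core_subset_sepComp ?_
    by_contra hA'
    exact hcon A hA hA' (hSi ▸ Set.inter_subset_left)
  have hBE : B ∈ level S Z (i + 2) :=
    SimpleGraph.Reachable.trans hAE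
      (cliqueGraphMinus_adj.mpr ⟨hAB, by rwa [hSi]⟩).reachable
  have him : i + 2 ≤ m := by
    by_contra him
    obtain rfl : m = i + 1 := by omega
    rw [hlast] at hBE
    exact hB' (hBE ▸ hZ _)
  have hex : ∃ j, ¬ level S Z (i + 2) ⊆ level S Z (j + 1) := ⟨i, fun hle => hB' (hle hBE)⟩
  have hji : Nat.find hex ≤ i := Nat.find_le fun hle => hB' (hle hBE)
  have hspec := Nat.find_spec hex
  have hEj : level S Z (i + 2) ⊆ level S Z (Nat.find hex) := by
    rcases hj : Nat.find hex with - | j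
    · exact fun _ _ => trivial
    · exact not_not.mp (Nat.find_min hex (m := j) (by omega))
  generalize Nat.find hex = j at hji hspec hEj
  obtain ⟨X, hX, hXj⟩ := Set.not_subset.mp hspec
  obtain ⟨hblock, hcore⟩ := h j hji
  have hclosed : ∀ u w, (cliqueGraphMinus G (S (i + 1))).Adj u w → u ∈ level S Z (i + 2) →
      w ∈ level S Z (i + 2) := fun u w huw hu => SimpleGraph.Reachable.trans hu huw.reachable
  -- an edge of `C(G) - S (i + 1)` leaving level `j + 1` has minimum weight
  have hleave : ∀ u w, (cliqueGraph G).Adj u w → u ∈ level S Z (i + 2) → w ∈ level S Z (i + 2) →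
      u ∈ level S Z (j + 1) → w ∉ level S Z (j + 1) →
      IsMinWeightEdge (cliqueGraphOn (level S Z (i + 2))) s(u, w) ∧
        IsMinWeightEdge (cliqueGraphOn (level S Z j)) s(u, w) ∧ u.1 ∩ w.1 = S j := by
    intro u w huw hu hw huj hwj
    rw [hcore] at huj hwj
    have h1 := isMinWeightEdge_of_core hblock.mem huw huj (hEj hw) hwj
    refine ⟨⟨⟨huw, hu, hw⟩, fun f hf => ?_⟩, h1,
      (hcrit j (by omega)).label_eq hblock.mem huw huj (hEj hw) hwj⟩
    induction f with | _ P Q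
    exact h1.le hf.1 (hEj hf.2.1) (hEj hf.2.2)
  have hcross : ∃ P Q, (cliqueGraph G).Adj P Q ∧ P ∈ level S Z (i + 2) ∧ Q ∈ level S Z (i + 2) ∧
      P ∈ level S Z (j + 1) ∧ Q ∉ level S Z (j + 1) := by
    by_contra! hno
    refine hXj (reachable_induction
      (P := fun u => u ∈ level S Z (i + 2) ∧ u ∈ level S Z (j + 1)) hX ⟨hZ _, hZ _⟩ ?_).2
    rintro u w huw ⟨hu, hu'⟩
    have hw := hclosed u w huw hu
    exact ⟨hw, hno u w (cliqueGraphMinus_adj.mp huw).1 hu hw hu'⟩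
  obtain ⟨P, Q, hPQ, hPE, hQE, hPj, hQj⟩ := hcross
  obtain ⟨hminE, hminj, -⟩ := hleave P Q hPQ hPE hQE hPj hQj
  have hcritical : ∃ u w, IsCriticalEdge (cliqueGraphOn (level S Z (i + 2))) Z s(u, w) ∧
      u.1 ∩ w.1 = S j := by
    by_contra! hno
    refine hXj (reachable_induction (P := fun u => u ∈ level S Z (i + 2) ∧
      u ∈ core (level S Z (i + 2)) Z ∧ u ∈ level S Z (j + 1)) hX ⟨hZ _, self_mem_core, hZ _⟩ ?_).2.2
    rintro u w huw ⟨hu, huc, huj⟩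
    have hw := hclosed u w huw hu
    have huw' := (cliqueGraphMinus_adj.mp huw).1
    have hwj : w ∈ level S Z (j + 1) := by
      by_contra hwj
      obtain ⟨h1, -, h2⟩ := hleave u w huw' hu hw huj hwj
      exact hno u w ⟨h1, u, by simp, huc⟩ h2
    refine ⟨hw, SimpleGraph.Reachable.trans huc (SimpleGraph.Adj.reachable ?_), hwj⟩
    refine heavyGraph_adj.mpr ⟨⟨huw', hu, hw⟩, fun hmin => ?_⟩
    rw [hcore] at huj hwj
    refine not_isMinWeightEdge_of_mem_core huw' huj hwj
      ⟨⟨huw', hEj hu, hEj hw⟩, fun f hf => (hmin.le hPQ hPE hQE).trans (hminj.2 f hf)⟩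
  obtain ⟨u, w, huw, hlabel⟩ := hcritical
  refine criticalLabels_injective hcrit hlast (m - (i + 2)) j (i + 2) (by omega) (by omega) ?_
  rw [← hlabel, ← (hcrit (i + 2) him).2 _ huw]
  rfl

/-- The levels of a sequence of critical labels are blocks, each of which is the core of the one
before. -/
lemma isBlock_level [Finite V] (hG : IsChordal G)
    (hcrit : ∀ i ≤ m, IsCriticalLabel (cliqueGraphOn (level S Z i)) Z (S i))
    (hlast : level S Z (m + 1) = {Z}) :
    ∀ i ≤ m, IsBlock (level S Z i) Z ∧ level S Z (i + 1) = core (level S Z i) Z := by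
  intro i
  induction i using Nat.strong_induction_on with
  | _ i ih =>
    intro hi
    rcases i with - | i
    · refine ⟨isBlock_univ hG, sepComp_eq_core_univ ?_⟩
      rw [← cliqueGraphOn_univ]
      exact hcrit 0 hi
    · have hprev := ih i (by omega) (by omega)
      have hblock : IsBlock (level S Z (i + 1)) Z := by
        rw [hprev.2]
        exact hprev.1.core
      obtain ⟨A, hA, hA', hSA⟩ := exists_entrance hcrit hlast hi
        fun j hj => ih j (by omega) (by omega)
      exact ⟨hblock, IsBlock.sepComp_eq_core hG hblock (hcrit (i + 1) hi) hA hA' hSA⟩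

lemma isPrimVisited_compl_level [Finite V] (hG : IsChordal G)
    (hcrit : ∀ i ≤ m, IsCriticalLabel (cliqueGraphOn (level S Z i)) Z (S i))
    (hlast : level S Z (m + 1) = {Z}) {K : MaxClique G} (hK : K ∉ level S Z 1) :
    ∀ i ≤ m, IsPrimVisited K (level S Z (i + 1))ᶜ := by
  have hlevel := isBlock_level hG hcrit hlast
  intro i
  induction i with
  | zero =>
    intro hi
    obtain ⟨h1, h2⟩ := hlevel 0 hi
    rw [h2] at hK ⊢
    refine IsPrimVisited.compl_core hG h1 (hcrit 0 hi) (A := K) trivial hK ?_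
    have : insert K (level S Z 0)ᶜ = {K} := by simp [level]
    rw [this]
    exact isPrimVisited_singleton
  | succ i ih =>
    intro hi
    obtain ⟨h1, h2⟩ := hlevel (i + 1) hi
    obtain ⟨A, hA, hA', hSA⟩ := exists_entrance hcrit hlast hi
      fun j hj => hlevel j (by omega)
    rw [h2]
    refine IsPrimVisited.compl_core hG h1 (hcrit (i + 1) hi) hA hA'
      ((ih (by omega)).insert_step ⟨fun h => h hA, ?_⟩)
    obtain ⟨P, Q, -, -, -, hQ, hPQ, -⟩ := (hcrit i (by omega)).exists_core
    rw [← (hlevel i (by omega)).2] at hQ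
    obtain ⟨hadj, hlabel⟩ := hG.adj_of_subset (S := S i) (A := Q) (B := A)
      (hPQ ▸ Set.inter_subset_right) hSA
      fun hr => hQ (SimpleGraph.Reachable.trans hA hr.symm)
    refine ⟨Q, hQ, hadj, fun X hX Y hY hXY => Set.ncard_le_ncard ?_ (Set.toFinite _)⟩
    change X.1 ∩ Y.1 ⊆ Q.1 ∩ A.1
    rw [hlabel]
    by_contra hnot
    exact hX (SimpleGraph.Reachable.trans (not_not.mp hY : Y ∈ level S Z (i + 1))
      (cliqueGraphMinus_adj.mpr ⟨hXY, hnot⟩).reachable.symm)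

end Levels

/-! ### Analysis of Prim orderings -/

section Analysis

variable {V : Type*} {G : SimpleGraph V} {π : CliqueOrdering G} {Z F : MaxClique G}
  {D : Set (MaxClique G)}

lemma EndsWith.le (h : EndsWith π Z) (K : MaxClique G) : π K ≤ π Z := by
  have := (π K).isLt
  unfold EndsWith at h
  exact Fin.le_def.mpr (by omega)

/-- In a Prim ordering whose last part, starting with `F`, visits the block `D`, every clique of `D`
but `F` is included through an edge inside `D`. -/
lemma IsPrimOrdering.exists_adj_of_block (hπ : IsPrimOrdering π)
    (hD : IsBlock D Z) (hF : ∀ K, K ∈ D ↔ π F ≤ π K) {X : MaxClique G} (hX : X ∈ D)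
    (hXF : X ≠ F) : ∃ Y ∈ D, π Y < π X ∧ (cliqueGraph G).Adj Y X := by
  have hlt : π F < π X := lt_of_le_of_ne ((hF X).mp hX) fun h => hXF (π.injective h.symm)
  have hFD : F ∈ D := (hF F).mpr le_rfl
  obtain ⟨Y, hYX, hadj, hmax⟩ := hπ X (lt_of_le_of_lt (Nat.zero_le _) hlt)
  refine ⟨Y, ?_, hYX, hadj⟩
  by_contra hY
  have hcross : ∃ U W, (cliqueGraphOn D).Adj U W ∧ π U < π X ∧ π X ≤ π W := by
    by_contra! hcon
    exact lt_irrefl _ (reachable_induction (P := fun U => π U < π X)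
      ((hD.conn F hFD).symm.trans (hD.conn X hX)) hlt hcon)
  obtain ⟨U, W, ⟨hUW, hU, hW⟩, h1, h2⟩ := hcross
  have h3 := hmax U W h1 h2 hUW
  have h4 := hD.lt U W X Y hUW hU hW hadj.symm hX hY
  rw [Sym2.eq_swap] at h4
  omega

/-- If the last part of a Prim ordering ending with `Z` visits a block `D`, then the very last part
visits the core of `D`. -/
lemma IsPrimOrdering.exists_first_core [Finite V] (hπ : IsPrimOrdering π) (hend : EndsWith π Z)
    (hD : IsBlock D Z) (hF : ∀ K, K ∈ D ↔ π F ≤ π K) {K : MaxClique G} (hK : K ∈ D)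
    (hKZ : K ≠ Z) :
    F ∉ core D Z ∧ ∃ B ∈ core D Z, ∀ X, X ∈ core D Z ↔ π B ≤ π X := by
  have hsub := core_subset hD.mem
  obtain ⟨X₀, hX₀, hX₀'⟩ := hD.exists_notMem_core hK hKZ
  obtain ⟨P, Q, hPQ, hP, hQ, hQ', -⟩ := hD.exists_boundary hX₀ hX₀'
  have hmin := isMinWeightEdge_of_core hD.mem hPQ hP hQ hQ'
  obtain ⟨B, hB, hBmin⟩ :=
    (Set.toFinite (core D Z)).exists_minimalFor π _ ⟨Z, self_mem_core⟩
  have hBle : ∀ X ∈ core D Z, π B ≤ π X := fun X hX =>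
    (le_total _ _).elim id fun h => hBmin hX h
  -- no clique of `D` outside the core is visited after the core has been entered
  have hbefore : ∀ X ∈ D, X ∉ core D Z → π X < π B := by
    by_contra! hcon
    obtain ⟨X, ⟨hX, hX', hBX⟩, hXmin⟩ :=
      (Set.toFinite {X | X ∈ D ∧ X ∉ core D Z ∧ π B ≤ π X}).exists_minimalFor π _ hcon
    have hBX' : π B < π X := lt_of_le_of_ne hBX fun h => hX' (π.injective h ▸ hB)
    obtain ⟨Y, hYX, hadj, hmax⟩ := hπ X (lt_of_le_of_lt (Nat.zero_le _) hBX')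
    have hle : weight s(Y, X) ≤ weight s(P, Q) := by
      by_cases hY : Y ∈ core D Z
      · exact (isMinWeightEdge_of_core hD.mem hadj hY hX hX').le hPQ (hsub hP) hQ
      · have hYB : π Y < π B := by
          by_contra! hBY
          by_cases hYD : Y ∈ D
          · exact absurd (hXmin (j := Y) ⟨hYD, hY, hBY⟩ hYX.le) (not_le.mpr hYX)
          · exact hYD ((hF Y).mpr (((hF B).mp (hsub hB)).trans hBY))
        obtain ⟨A, hAB, hABadj, hmaxB⟩ := hπ B (lt_of_le_of_lt (Nat.zero_le _) hYB)
        refine (hmaxB Y X hYB hBX hadj).trans ?_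
        have hA : A ∉ core D Z := fun hA => absurd (hBle A hA) (not_le.mpr hAB)
        rw [Sym2.eq_swap]
        by_cases hAD : A ∈ D
        · exact (isMinWeightEdge_of_core hD.mem hABadj.symm hB hAD hA).le hPQ (hsub hP) hQ
        · exact (hD.lt P Q B A hPQ (hsub hP) hQ hABadj.symm (hsub hB) hAD).le
    have hcross : ∃ U W, (cliqueGraphOn (core D Z)).Adj U W ∧ π U < π X ∧ π X ≤ π W := by
      by_contra! hcon
      exact absurd (hend.le X) (not_le.mpr (reachable_induction (P := fun U => π U < π X)
        (hD.core.conn B hB).symm hBX' hcon))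
    obtain ⟨U, W, ⟨hUW, hU, hW⟩, h1, h2⟩ := hcross
    have h3 := hmax U W h1 h2 hUW
    have h4 := hD.core.lt U W P Q hUW hU hW hPQ hP hQ'
    omega
  refine ⟨fun hFc => ?_, B, hB, fun X => ⟨hBle X, fun hX => ?_⟩⟩
  · exact absurd ((hF X₀).mp hX₀) (not_le.mpr
      ((hbefore X₀ hX₀ hX₀').trans_le (hBle F hFc)))
  · by_contra hX'
    exact absurd (hbefore X ((hF X).mpr (((hF B).mp (hsub hB)).trans hX)) hX') (not_lt.mpr hX)

/-- In the situation of `IsPrimOrdering.exists_first_core`, the critical edges of `D` have a common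
label `S`, which is also the label of an edge `AB` from the rest of `D` to the first clique `B` of
the core. -/
lemma IsPrimOrdering.exists_critical [Finite V] (hG : IsChordal G) (hπ : IsPrimOrdering π)
    (hend : EndsWith π Z) (hD : IsBlock D Z) (hF : ∀ K, K ∈ D ↔ π F ≤ π K) {K : MaxClique G}
    (hK : K ∈ D) (hKZ : K ≠ Z) :
    F ∉ core D Z ∧ ∃ A B, (cliqueGraph G).Adj A B ∧
      IsCriticalLabel (cliqueGraphOn D) Z (label s(A, B)) ∧
      (∀ X, X ∈ core D Z ↔ π B ≤ π X) ∧
      (cliqueGraphOn (D \ core D Z)).Reachable F A := by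
  obtain ⟨hFc, B, hB, hBiff⟩ := hπ.exists_first_core hend hD hF hK hKZ
  have hsub := core_subset hD.mem
  have hFD : F ∈ D := (hF F).mpr le_rfl
  have hreach : ∀ k : ℕ, ∀ X ∈ D, X ∉ core D Z → (π X).val = k →
      (cliqueGraphOn (D \ core D Z)).Reachable F X := by
    intro k
    induction k using Nat.strong_induction_on with
    | _ k ih =>
      intro X hX hX' hk
      by_cases hXF : X = F
      · rw [hXF]
      obtain ⟨Y, hY, hYX, hadj⟩ := hπ.exists_adj_of_block hD hF hX hXF
      have hY' : Y ∉ core D Z := fun hY' => hX' ((hBiff X).mpr (((hBiff Y).mp hY').trans hYX.le))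
      exact (ih (π Y) (by rw [← hk]; exact hYX) Y hY hY' rfl).trans
        (SimpleGraph.Adj.reachable ⟨hadj, ⟨hY, hY'⟩, hX, hX'⟩)
  obtain ⟨S, hS⟩ := hD.exists_isCriticalLabel hG hK hKZ fun X hX hX' Y hY hY' =>
    (hreach _ X hX hX' rfl).symm.trans (hreach _ Y hY hY' rfl)
  obtain ⟨A, hA, hAB, hadj⟩ :=
    hπ.exists_adj_of_block hD hF (hsub hB) (fun h => hFc (h ▸ hB))
  have hA' : A ∉ core D Z := fun hA' => absurd ((hBiff A).mp hA') (not_le.mpr hAB)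
  have hlabel : label s(A, B) = S := by
    rw [Sym2.eq_swap]
    exact hS.label_eq hD.mem hadj.symm hB hA hA'
  exact ⟨hFc, A, B, hadj, hlabel ▸ hS, hBiff, hreach _ A hA hA' rfl⟩

lemma cliqueGraphOn_le : cliqueGraphOn D ≤ cliqueGraph G := fun _ _ h => h.1

lemma support_subset_of_walk {A B : MaxClique G} (p : (cliqueGraphOn D).Walk A B) (hA : A ∈ D) :
    ∀ X ∈ p.support, X ∈ D := by
  induction p with
  | nil => simpa using hA
  | cons h _ ih =>
    rw [SimpleGraph.Walk.support_cons, List.forall_mem_cons]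
    exact ⟨hA, ih h.2.2⟩

/-- A path from `F` to `A` in `D` outside `D'`, an edge `AB`, and a path from `B` to `Z` inside `D'`
combine to a path from `F` to `Z` inside `D`. -/
lemma exists_path_cons {D' : Set (MaxClique G)} (hsub : D' ⊆ D) {A B : MaxClique G} (hF : F ∈ D)
    (hF' : F ∉ D') (hAB : (cliqueGraph G).Adj A B) (hr : (cliqueGraphOn (D \ D')).Reachable F A)
    {L : List (Sym2 (MaxClique G))}
    (hp : ∃ p : (cliqueGraph G).Walk B Z, p.IsPath ∧ (∀ X ∈ p.support, X ∈ D') ∧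
      L.Sublist p.edges) :
    ∃ p : (cliqueGraph G).Walk F Z, p.IsPath ∧ (∀ X ∈ p.support, X ∈ D) ∧
      (s(A, B) :: L).Sublist p.edges := by
  classical
  obtain ⟨p, hp, hpD, hL⟩ := hp
  obtain ⟨q, hq⟩ := hr.exists_isPath
  have hqD := support_subset_of_walk q ⟨hF, hF'⟩
  have hq' : (q.mapLe cliqueGraphOn_le).IsPath := hq.mapLe _
  rw [← SimpleGraph.Walk.support_mapLe_eq_support cliqueGraphOn_le q] at hqD
  generalize q.mapLe cliqueGraphOn_le = r at hq' hqD
  refine ⟨r.append (SimpleGraph.Walk.cons hAB p), ?_, ?_, ?_⟩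
  · rw [SimpleGraph.Walk.isPath_def, SimpleGraph.Walk.support_append,
      SimpleGraph.Walk.support_cons, List.tail_cons]
    refine List.Nodup.append hq'.support_nodup hp.support_nodup ?_
    exact fun X hX hX' => (hqD X hX).2 (hpD X hX')
  · intro X hX
    rw [SimpleGraph.Walk.support_append, SimpleGraph.Walk.support_cons, List.tail_cons,
      List.mem_append] at hX
    exact hX.elim (fun h => (hqD X h).1) fun h => hsub (hpD X h)
  · rw [SimpleGraph.Walk.edges_append, SimpleGraph.Walk.edges_cons]
    exact (hL.cons_cons _).trans (List.sublist_append_right _ _)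

/-- The list of edges found by applying `IsPrimOrdering.exists_critical` to one core after
another. -/
lemma IsPrimOrdering.exists_list [Finite V] (hG : IsChordal G) (hπ : IsPrimOrdering π) {z : V}
    (hz : IsSimplicial G z) (hend : EndsWith π (nbhdClique hz)) (k : ℕ) :
    ∀ A B : MaxClique G, (cliqueGraph G).Adj A B → Nat.card (MaxClique G) - (π B).val = k →
      IsBlock (sepComp (label s(A, B)) (nbhdClique hz)) (nbhdClique hz) →
      (∀ X, X ∈ sepComp (label s(A, B)) (nbhdClique hz) ↔ π B ≤ π X) →
      ∃ L : List (Sym2 (MaxClique G)),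
        (s(A, B) :: L).IsChain (fun e f => IsCriticalLabel
          (cliqueGraphOn (sepComp (label e) (nbhdClique hz))) (nbhdClique hz) (label f)) ∧
        label ((s(A, B) :: L).getLast (by simp)) = {v ∈ closedNbhd G z | ¬ IsSimplicial G v} ∧
        ∃ p : (cliqueGraph G).Walk B (nbhdClique hz), p.IsPath ∧
          (∀ X ∈ p.support, X ∈ sepComp (label s(A, B)) (nbhdClique hz)) ∧
          L.Sublist p.edges := by
  induction k using Nat.strong_induction_on with
  | _ k ih =>
    intro A B hAB hk hD hB
    have hBD := (hB B).mpr le_rfl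
    by_cases hsingle : ∀ K ∈ sepComp (label s(A, B)) (nbhdClique hz), K = nbhdClique hz
    · obtain rfl := hsingle B hBD
      refine ⟨[], by simp, ?_, SimpleGraph.Walk.nil, by simp, by simpa using hBD, by simp⟩
      refine hG.eq_nonsimplicial hz hAB.symm (Set.inter_comm _ _) ?_
      exact subset_antisymm hsingle (by rintro _ rfl; exact hBD)
    · push Not at hsingle
      obtain ⟨K, hK, hKZ⟩ := hsingle
      obtain ⟨hBc, A', B', hAB', hcrit, hB', hr⟩ :=
        hπ.exists_critical hG hend hD hB hK hKZ
      have hcore := hD.sepComp_eq_core hG hcrit hBD hBc Set.inter_subset_right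
      have hlt : π B < π B' := by
        by_contra hle
        exact hBc ((hB' B).mpr (not_lt.mp hle))
      have hlt' : (π B).val < (π B').val := hlt
      have hblock := hD.core
      rw [← hcore] at hblock hB' hBc hr
      obtain ⟨L, hL, hlast, hp⟩ := ih _ (by have := (π B').isLt; omega) A' B' hAB' rfl hblock hB'
      refine ⟨s(A', B') :: L, List.isChain_cons_cons.mpr ⟨hcrit, hL⟩, ?_, ?_⟩
      · rwa [List.getLast_cons_cons]
      · exact exists_path_cons (hcore ▸ core_subset hD.mem) hBD hBc hAB' hr hp

lemma exists_maxClique_ne_of_ne_top [Finite V] (hG : G ≠ ⊤) (K : MaxClique G) :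
    ∃ K' : MaxClique G, K' ≠ K := by
  by_contra! hcon
  have hmem : ∀ x, x ∈ K.1 := by
    intro x
    obtain ⟨M, hM⟩ := exists_maxClique_superset (G := G) (s := {x}) (by simp)
    exact hcon M ▸ hM rfl
  refine hG (top_unique fun x y hxy => K.adj (hmem x) (hmem y) hxy)

lemma IsPrimOrdering.exists_isCriticalChain [Finite V] (hG : IsChordal G) (hne : G ≠ ⊤)
    (hπ : IsPrimOrdering π) {z : V} (hz : IsSimplicial G z) (hend : EndsWith π (nbhdClique hz)) :
    ∃ (m : ℕ) (e : Fin (m + 1) → Sym2 (MaxClique G)), IsCriticalChain hz e := by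
  obtain ⟨K, hK⟩ := exists_maxClique_ne_of_ne_top hne (nbhdClique hz)
  have hpos : 0 < Nat.card (MaxClique G) := by
    unfold EndsWith at hend
    omega
  obtain ⟨F, hF⟩ := π.surjective ⟨0, hpos⟩
  have hFiff : ∀ X, X ∈ (Set.univ : Set (MaxClique G)) ↔ π F ≤ π X := fun X => by
    simp [hF, Fin.le_def]
  have hD : IsBlock (Set.univ : Set (MaxClique G)) (nbhdClique hz) := isBlock_univ hG
  obtain ⟨hFc, A, B, hAB, hcrit, hB, hr⟩ :=
    hπ.exists_critical hG hend hD hFiff (K := K) trivial hK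
  rw [cliqueGraphOn_univ] at hcrit
  have hcore := sepComp_eq_core_univ hcrit
  have hblock := hD.core
  rw [← hcore] at hblock hB hFc hr
  obtain ⟨L, hL, hlast, hp⟩ := hπ.exists_list hG hz hend _ A B hAB rfl hblock hB
  obtain ⟨p, hp, -, hsub⟩ := exists_path_cons (Set.subset_univ _) (Set.mem_univ F) hFc hAB hr hp
  refine ⟨L.length, (s(A, B) :: L).get, ⟨⟨F, p, hp, ?_⟩, hcrit, ?_, fun i => ?_⟩⟩
  · rwa [List.ofFn_get]
  · rw [← hlast, List.getLast_eq_getElem]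
    rfl
  · rw [componentOf_cliqueGraphMinus]
    exact List.isChain_iff_getElem.mp hL i.val (by simp)

lemma IsCriticalChain.exists_isPrimOrdering [Finite V] (hG : IsChordal G) {z : V}
    {hz : IsSimplicial G z} {m : ℕ} {e : Fin (m + 1) → Sym2 (MaxClique G)}
    (he : IsCriticalChain hz e) {K : MaxClique G}
    (hK : ¬ (cliqueGraphMinus G (label (e 0))).Reachable (nbhdClique hz) K) :
    ∃ π : CliqueOrdering G, IsPrimOrdering π ∧ StartsWith π K ∧ EndsWith π (nbhdClique hz) := by
  let S : ℕ → Set V := fun i => label (e (Fin.ofNat (m + 1) i))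
  have hS : ∀ i : Fin (m + 1), S i = label (e i) := fun i => by simp [S]
  have hcrit : ∀ i ≤ m, IsCriticalLabel (cliqueGraphOn (level S (nbhdClique hz) i))
      (nbhdClique hz) (S i) := by
    rintro (- | i) hi
    · have h0 := he.first
      rw [← cliqueGraphOn_univ] at h0
      exact h0
    · have h := he.step ⟨i, hi⟩
      rw [componentOf_cliqueGraphMinus, ← hS, ← hS] at h
      exact h
  have hlast : level S (nbhdClique hz) (m + 1) = {nbhdClique hz} := by
    rw [← sepComp_nonsimplicial hz, ← he.last, ← hS]
    rfl
  refine IsPrimVisited.exists_isPrimOrdering hG ?_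
  rw [← hlast]
  exact isPrimVisited_compl_level hG hcrit hlast hK m le_rfl

end Analysis

end PrimEnd

/-! ### Prim orderings and critical chains -/

theorem mainTheorem2 {V : Type*} [Finite V] (G : SimpleGraph V) (hconn : G.Connected)
    (hchordal : PrimEnd.IsChordal G) (hncomplete : G ≠ ⊤) (z : V)
    (hz : PrimEnd.IsSimplicial G z) :
    ((∃ π : PrimEnd.CliqueOrdering G,
        PrimEnd.IsPrimOrdering π ∧ PrimEnd.EndsWith π (PrimEnd.nbhdClique hz)) ↔
      ∃ (m : ℕ) (e : Fin (m + 1) → Sym2 (PrimEnd.MaxClique G)),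
        PrimEnd.IsCriticalChain hz e) ∧
    ∀ (m : ℕ) (e : Fin (m + 1) → Sym2 (PrimEnd.MaxClique G)), PrimEnd.IsCriticalChain hz e →
      ∀ K : PrimEnd.MaxClique G,
        ¬ (PrimEnd.cliqueGraphMinus G (PrimEnd.label (e 0))).Reachable (PrimEnd.nbhdClique hz) K →
        ∃ π : PrimEnd.CliqueOrdering G, PrimEnd.IsPrimOrdering π ∧
          PrimEnd.StartsWith π K ∧ PrimEnd.EndsWith π (PrimEnd.nbhdClique hz) := by
  refine ⟨⟨?_, ?_⟩, fun m e he K hK => he.exists_isPrimOrdering hchordal hK⟩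
  · rintro ⟨π, hπ, hend⟩
    exact hπ.exists_isCriticalChain hchordal hncomplete hz hend
  · rintro ⟨m, e, he⟩
    -- one end of `e 0` lies outside the component of `N[z]`, so the traversal can start there
    obtain ⟨f, hf⟩ := he.first.1
    have hlabel := he.first.2 f hf
    have hK : ∃ K, ¬ (PrimEnd.cliqueGraphMinus G (PrimEnd.label (e 0))).Reachable
        (PrimEnd.nbhdClique hz) K := by
      induction f with | _ A B
      by_contra! hcon
      have hAB := PrimEnd.not_reachable_of_adj (K := A) (K' := B) hf.1.1
      rw [← hlabel] at hcon
      exact hAB ((hcon A).symm.trans (hcon B))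
    obtain ⟨K, hK⟩ := hK
    obtain ⟨π, hπ, -, hend⟩ := he.exists_isPrimOrdering hchordal hK
    exact ⟨π, hπ, hend⟩
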